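/- Let $\lambda>0$, let $d\ge 1$, let $B_r^d=\{x\in\mathbb R^d:\|x\|\le r\}$, let $S_+^{d-1}=\{v\in\mathbb R^d:\|v\|=1,\ v_d\ge 0\}$, and put $H(p,v)=\{x\in\mathbb R^d:\langle x,v\rangle=p\}$. Let $\Theta$ be a Borel probability measure on $S_+^{d-1}$ that is nondegenerate, i.e. $\Theta(L\cap S_+^{d-1})<1$ for every $(d-1)$-dimensional linear subspace $L$ of $\mathbb R^d$. Let $\Phi=\sum_{i\ge1}\delta_{H(P_i,V_i)}$ be the stationary Poisson hyperplane process with intensity $\lambda$ and spherical orientation distribution $\Theta$; that is, $\sum_{i\ge 1}\delta_{(P_i,V_i)}$ is a Poisson point process on $\mathbb R\times S_+^{d-1}$ with intensity measure $\lambda\,dp\otimes\Theta(dv)$. For $k\in\{0,\dots,d-1\}$ let $\nu_k$ be the $k$-dimensional volume ($k$-dimensional Hausdorff measure, normalized to agree with Lebesgue measure; counting measure if $k=0$), and let $$\Phi_k(\mathcal B)=\frac1{(d-k)!}\,\#\Big\{(H_1,\dots,H_{d-k}):\ H_1,\dots,H_{d-k}\in\operatorname{supp}\Phi \text{ pairwise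 distinct},\ \bigcap_{j}H_j\text{ is a }k\text{-dimensional affine subspace belonging to }\mathcal B\Big\}.$$ Let $\operatorname{supp}\Phi_k=\{L: L \text{ a } k\text{-dimensional affine subspace},\ \Phi_k(\{L\})\ge1\}$. Put $$\Psi_k(B_r^d)=\Phi_k(\{L:L\cap B_r^d\ne\emptyset\}),\qquad \zeta_k(B_r^d)=\sum_{L\in\operatorname{supp}\Phi_k}\nu_k(L\cap B_r^d),$$ the number of intersection $k$-flats hitting $B_r^d$ and their total $k$-volume in $B_r^d$. For $\rho>0$ let $X_1,\dots,X_{2(d-k)-1}$ be i.i.d. with $X_i=(P_i',V_i')$, where $P_i'$ is uniform on $[-\rho,\rho]$, $V_i'\sim\Theta$, and $P_i'$ and $V_i'$ are independent. With $\chi(K)=1$ for $K\ne\emptyset$ and $\chi(\emptyset)=0$, put $$\sigma_{\chi,k}^{(1,d-k)}=\mathbb E\Big[\chi\Big(\bigcap_{i=1}^{d-k}H(X_i)\cap B_\rho^d\Big)\,\chi\Big(\bigcap_{i=d-k}^{2(d-k)-1}H(X_i)\cap B_\rho^d\Big)\Big],$$ $$\sigma_{\nu,k}^{(1,d-k)}=\rho^{-2k}\,\mathbb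 E\Big[\nu_k\Big(\bigcap_{i=1}^{d-k}H(X_i)\cap B_\rho^d\Big)\,\nu_k\Big(\bigcap_{i=d-k}^{2(d-k)-1}H(X_i)\cap B_\rho^d\Big)\Big].$$ **Theorem.** For each $k=0,1,\dots,d-1$ and every choice of $\rho>0$ in the definition of the variances, $\Psi_k(B_r^d)$ and $\zeta_k(B_r^d)$ are integrable for all $r$, and $$\frac{(d-k-1)!}{(2\lambda r)^{d-k-1/2}}\big(\Psi_k(B_r^d)-\mathbb E\Psi_k(B_r^d)\big)\xrightarrow[r\to\infty]{d}\mathcal N\big(0,\sigma_{\chi,k}^{(1,d-k)}\big),$$ $$\frac{(d-k-1)!\,r^{-k}}{(2\lambda r)^{d-k-1/2}}\big(\zeta_k(B_r^d)-\mathbb E\zeta_k(B_r^d)\big)\xrightarrow[r\to\infty]{d}\mathcal N\big(0,\sigma_{\nu,k}^{(1,d-k)}\big).$$ -/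

import Mathlib

open MeasureTheory ProbabilityTheory Filter
open scoped ENNReal NNReal Nat

noncomputable section

/-- The Euclidean space `ℝ^d`. -/
abbrev E (d : ℕ) : Type := EuclideanSpace ℝ (Fin d)

/-- The closed upper unit hemisphere: unit vectors whose last coordinate is nonnegative. -/
abbrev UpperHemisphere (d : ℕ) : Type :=
  {v : E d // ‖v‖ = 1 ∧ ∀ i : Fin d, (i : ℕ) + 1 = d → 0 ≤ v i}

/-- Parameters `(p, v)` of hyperplanes: signed distance from the origin and orientation vector. -/
abbrev Param (d : ℕ) : Type := ℝ × UpperHemisphere d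

/-- The hyperplane `H(p, v) = {x : ⟨x, v⟩ = p}`. -/
def hyperplane {d : ℕ} (a : Param d) : Set (E d) :=
  {x | inner ℝ x (a.2 : E d) = a.1}

/-- The `k`-dimensional affine subspaces of `ℝ^d`, as point sets. -/
def flats (d k : ℕ) : Set (Set (E d)) :=
  {L | ∃ A : AffineSubspace ℝ (E d),
    (A : Set (E d)).Nonempty ∧ Module.finrank ℝ A.direction = k ∧ (A : Set (E d)) = L}

/-- The sets that have a point in the closed ball of radius `r` around the origin. -/
def hitsBall (d : ℕ) (r : ℝ) : Set (Set (E d)) :=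
  {L | (L ∩ Metric.closedBall 0 r).Nonempty}

/-- `Θ` is nondegenerate: no hyperplane through the origin carries all the mass. -/
def NondegenerateOrientation {d : ℕ} (Θ : Measure (UpperHemisphere d)) : Prop :=
  ∀ L : Submodule ℝ (E d), Module.finrank ℝ L + 1 = d →
    Θ {v : UpperHemisphere d | (v : E d) ∈ L} < 1

/-- The number of points of the point process `∑ i, δ_{X i}` that lie in `B`. -/
def pointCount {Ω : Type*} {d : ℕ} (X : ℕ → Ω → Param d) (B : Set (Param d)) (ω : Ω) : ℕ∞ :=
  Set.encard {i : ℕ | X i ω ∈ B}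

/-- The intensity measure `lam · dp ⊗ Θ(dv)` on the parameter space. -/
def intensityMeasure {d : ℕ} (lam : ℝ) (Θ : Measure (UpperHemisphere d)) : Measure (Param d) :=
  (ENNReal.ofReal lam • (volume : Measure ℝ)).prod Θ

/-- The random points `X i = (P_i, V_i)` form a Poisson point process on `ℝ × S_+^{d-1}` with
intensity measure `lam · dp ⊗ Θ(dv)`, so that the random hyperplanes `H(P_i, V_i)` form a
stationary Poisson hyperplane process with intensity `lam` and spherical orientation
distribution `Θ`. -/
structure IsPoissonHyperplaneProcess {Ω : Type*} [MeasurableSpace Ω] (P : Measure Ω) {d : ℕ}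
    (lam : ℝ) (Θ : Measure (UpperHemisphere d)) (X : ℕ → Ω → Param d) : Prop where
  measurable : ∀ i, Measurable (X i)
  count_poisson : ∀ B : Set (Param d), MeasurableSet B → intensityMeasure lam Θ B ≠ ∞ →
    HasLaw (pointCount X B)
      ((poissonMeasure (intensityMeasure lam Θ B).toNNReal).map (Nat.cast : ℕ → ℕ∞)) P
  count_indep : ∀ (n : ℕ) (B : Fin n → Set (Param d)), (∀ j, MeasurableSet (B j)) →
    Pairwise (fun i j => Disjoint (B i) (B j)) → iIndepFun (fun j => pointCount X (B j)) P

/-- The support of the hyperplane process: the set of all its hyperplanes. -/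
def hyperplanes {Ω : Type*} {d : ℕ} (X : ℕ → Ω → Param d) (ω : Ω) : Set (Set (E d)) :=
  Set.range fun i => hyperplane (X i ω)

/-- The `k`-flat intersection process `Φ_k` of a family of hyperplanes, evaluated on a class of
sets: `1/(d-k)!` times the number of `(d-k)`-tuples of distinct hyperplanes whose intersection is
a `k`-flat that belongs to the class. -/
def flatProcess {d : ℕ} (ℋ : Set (Set (E d))) (k : ℕ) (ℬ : Set (Set (E d))) : ℝ≥0∞ :=
  (∑' H : Fin (d - k) ↪ ℋ, (flats d k ∩ ℬ).indicator 1 (⋂ j, (H j : Set (E d)))) / (d - k)!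

/-- `supp Φ_k`, the `k`-flats `L` with `Φ_k({L}) ≥ 1`. -/
def flatSupport {d : ℕ} (ℋ : Set (Set (E d))) (k : ℕ) : Set (Set (E d)) :=
  {L | L ∈ flats d k ∧ 1 ≤ flatProcess ℋ k {L}}

/-- `Ψ_k(B_r^d)`, the number of intersection `k`-flats that hit the ball. -/
def flatNumber {Ω : Type*} {d : ℕ} (X : ℕ → Ω → Param d) (k : ℕ) (r : ℝ) (ω : Ω) : ℝ :=
  (flatProcess (hyperplanes X ω) k (hitsBall d r)).toReal

/-- `ζ_k(B_r^d)`, the total `k`-volume of the intersection `k`-flats inside the ball. -/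
def flatVolume {Ω : Type*} {d : ℕ} (X : ℕ → Ω → Param d) (k : ℕ) (r : ℝ) (ω : Ω) : ℝ :=
  (∑' L : flatSupport (hyperplanes X ω) k,
    μHE[k] ((L : Set (E d)) ∩ Metric.closedBall 0 r)).toReal

/-- The law of `(P, V)` with `P` uniform on `[-ρ, ρ]` and `V ∼ Θ` independent. -/
def sampleLaw {d : ℕ} (Θ : Measure (UpperHemisphere d)) (ρ : ℝ) : Measure (Param d) :=
  (ProbabilityTheory.cond (volume : Measure ℝ) (Set.Icc (-ρ) ρ)).prod Θ

/-- `⋂_{i=1}^{m} H(x_i)`, for a family of `2m - 1` parameters (indexed from `0` here). -/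
def firstIntersection {d m : ℕ} (x : Fin (2 * m - 1) → Param d) : Set (E d) :=
  ⋂ i : {i : Fin (2 * m - 1) // (i : ℕ) + 1 ≤ m}, hyperplane (x i)

/-- `⋂_{i=m}^{2m-1} H(x_i)`, for a family of `2m - 1` parameters (indexed from `0` here). -/
def secondIntersection {d m : ℕ} (x : Fin (2 * m - 1) → Param d) : Set (E d) :=
  ⋂ i : {i : Fin (2 * m - 1) // m ≤ (i : ℕ) + 1}, hyperplane (x i)

/-- The asymptotic variance `σ_{χ,k}^{(1,d-k)}`, computed from i.i.d. hyperplanes that hit the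
ball of radius `ρ`. -/
def sigmaChi {d : ℕ} (Θ : Measure (UpperHemisphere d)) (k : ℕ) (ρ : ℝ) : ℝ≥0 :=
  (∫⁻ x : Fin (2 * (d - k) - 1) → Param d,
    (hitsBall d ρ).indicator 1 (firstIntersection x) *
      (hitsBall d ρ).indicator 1 (secondIntersection x)
    ∂(Measure.pi fun _ => sampleLaw Θ ρ)).toNNReal

/-- The asymptotic variance `σ_{ν,k}^{(1,d-k)}`, computed from i.i.d. hyperplanes that hit the
ball of radius `ρ`. -/
def sigmaNu {d : ℕ} (Θ : Measure (UpperHemisphere d)) (k : ℕ) (ρ : ℝ) : ℝ≥0 :=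
  ((ENNReal.ofReal (ρ ^ (2 * k)))⁻¹ *
    ∫⁻ x : Fin (2 * (d - k) - 1) → Param d,
      μHE[k] (firstIntersection x ∩ Metric.closedBall 0 ρ) *
        μHE[k] (secondIntersection x ∩ Metric.closedBall 0 ρ)
      ∂(Measure.pi fun _ => sampleLaw Θ ρ)).toNNReal

end

/-! Almost surely the hyperplanes are in general position: finitely many of them with a common point
have linearly independent normals (`ae_inGeneralPosition`). Every intersection `k`-flat then comes
from exactly `(d-k)!` ordered tuples. Up to that factor, both statistics are therefore Poisson
U-statistics of order `m = d-k = n+1`, i.e. sums of a symmetric kernel (`hitKernel`, `volumeKernel`)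
over tuples of distinct points.

Dilation by `ρ/r` carries the ball of radius `r` to the one of radius `ρ`. The kernel becomes fixed
and bounded, and the growth of `r` moves into the intensity: on the parameters of hyperplanes
meeting the fixed ball it equals `t Q`, with `t = 2 lam r` and `Q = sampleLaw Θ ρ`. The mass `t`
does not depend on `ρ`, which is why every `ρ` is allowed.

It remains to prove a central limit theorem for such U-statistics `F` as `t → ∞`
(`tendstoInDistribution_tsum_embedding`). Let `μ` be the intensity, `L` the sum over the points of
the kernel with all entries but one integrated out (`firstKernel`), `M` the common mean of `F` and
`L`, and `v = ∫ (firstKernel μ g)² dμ`. The factorial moment measures of a Poisson process are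
product measures (`momentMeasure_eq`), whence `E[FL] = M² + m v`, `E[L²] = M² + v` and `E[F²] ≤ M² +
m² v + O(t^(2n))`. So `F - M - m (L - M)` has second moment `O(t^(2n))`, while the squared scale is
of order `t^(2n+1)`: `F` may be replaced by its linear projection. The limit law of the linear
statistic follows from the characteristic functional (`tendstoInDistribution_tsum`). Its variance `∫
(firstKernel Q g)² dQ` is the expected product of two kernels sharing one entry, which is the
variance in the theorem (`coe_sigmaChi`, `coe_sigmaNu`). -/

/-- The random points `Y i` form a Poisson point process with intensity measure `μ`. -/
structure IsPoissonProcess {Ω β : Type*} [MeasurableSpace Ω] [MeasurableSpace β] (P : Measure Ω)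
    (μ : Measure β) (Y : ℕ → Ω → β) : Prop where
  measurable : ∀ i, Measurable (Y i)
  count_poisson : ∀ B : Set β, MeasurableSet B → μ B ≠ ∞ →
    HasLaw (fun ω => Set.encard {i : ℕ | Y i ω ∈ B})
      ((poissonMeasure (μ B).toNNReal).map (Nat.cast : ℕ → ℕ∞)) P
  count_indep : ∀ (n : ℕ) (B : Fin n → Set β), (∀ j, MeasurableSet (B j)) →
    Pairwise (fun i j => Disjoint (B i) (B j)) →
    iIndepFun (fun j ω => Set.encard {i : ℕ | Y i ω ∈ B j}) P

/-! ### Factorial moment measures of a Poisson process. -/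

/-- The falling factorial kills the first `k` terms and cancels against `n!` in the others; shifting
the series by `k` leaves `t ^ k` times the total mass. -/
lemma lintegral_descFactorial_poissonMeasure (t : ℝ≥0) (k : ℕ) :
    ∫⁻ n, (n.descFactorial k : ℝ≥0∞) ∂(poissonMeasure t) = (t : ℝ≥0∞) ^ k := by
  rw [poissonMeasure, lintegral_sum_measure]
  simp only [lintegral_smul_measure, lintegral_dirac, smul_eq_mul]
  rw [← ENNReal.summable.sum_add_tsum_nat_add' (k := k)]
  have h0 : ∑ i ∈ Finset.range k, ENNReal.ofReal (Real.exp (-t) * t ^ i / i !) *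
      (i.descFactorial k : ℝ≥0∞) = 0 := by
    refine Finset.sum_eq_zero fun i hi => ?_
    rw [Nat.descFactorial_eq_zero_iff_lt.2 (Finset.mem_range.1 hi)]
    simp
  have h1 : ∀ i : ℕ, ENNReal.ofReal (Real.exp (-t) * t ^ (i + k) / (i + k)!) *
      ((i + k).descFactorial k : ℝ≥0∞)
        = (t : ℝ≥0∞) ^ k * ENNReal.ofReal (Real.exp (-t) * t ^ i / i !) := by
    intro i
    have h2 : (i ! : ℝ) * ((i + k).descFactorial k : ℝ) = ((i + k)! : ℝ) := by
      have := Nat.factorial_mul_descFactorial (n := i + k) (k := k) (by omega)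
      rw [Nat.add_sub_cancel] at this
      exact_mod_cast this
    have h3 : (((i + k).descFactorial k : ℕ) : ℝ≥0∞) =
        ENNReal.ofReal ((i + k).descFactorial k : ℝ) := by
      rw [ENNReal.ofReal_natCast]
    have h4 : (t : ℝ≥0∞) ^ k = ENNReal.ofReal ((t : ℝ) ^ k) := by
      rw [ENNReal.ofReal_pow (NNReal.coe_nonneg t), ENNReal.ofReal_coe_nnreal]
    rw [h3, h4, ← ENNReal.ofReal_mul (by positivity), ← ENNReal.ofReal_mul (by positivity)]
    congr 1
    rw [← h2]
    have : ((i + k).descFactorial k : ℝ) ≠ 0 := by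
      have : (i + k).descFactorial k ≠ 0 := by
        rw [Ne, Nat.descFactorial_eq_zero_iff_lt]; omega
      exact_mod_cast this
    field_simp
    ring
  rw [h0, zero_add]
  simp_rw [h1]
  rw [ENNReal.tsum_mul_left, ← ENNReal.ofReal_tsum_of_nonneg (fun n => by positivity)
    (hasSum_one_poissonMeasure t).summable, (hasSum_one_poissonMeasure t).tsum_eq]
  simp

/-- The embeddings that respect given colourings split into their restrictions to the colour
classes. -/
def embeddingColorEquiv {ι N κ : Type*} (s : ι → κ) (c : N → κ) :
    {a : ι ↪ N // ∀ j, c (a j) = s j} ≃ (∀ S : κ, {j // s j = S} ↪ {i // c i = S}) where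
  toFun a S := ⟨fun j => ⟨a.1 j.1, (a.2 j.1).trans j.2⟩, fun x y h => by
    apply Subtype.ext; apply a.1.injective; exact congrArg Subtype.val h⟩
  invFun b := ⟨⟨fun j => (b (s j) ⟨j, rfl⟩).1, fun x y h => by
    have hs : s x = s y := by
      rw [← (b (s x) ⟨x, rfl⟩).2, ← (b (s y) ⟨y, rfl⟩).2]; exact congrArg c h
    have key : ∀ S (hx : s x = S) (hy : s y = S), (b S ⟨x, hx⟩).1 = (b S ⟨y, hy⟩).1 → x = y := by
      intro S hx hy h'
      have := (b S).injective (Subtype.ext h')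
      exact congrArg Subtype.val this
    refine key (s y) hs rfl ?_
    have e : ∀ S (hx : s x = S), (b S ⟨x, hx⟩).1 = (b (s x) ⟨x, rfl⟩).1 := by
      rintro S rfl; rfl
    rw [e]; exact h⟩, fun j => (b (s j) ⟨j, rfl⟩).2⟩
  left_inv a := by ext; rfl
  right_inv b := by
    funext S; ext ⟨j, hj⟩; subst hj; rfl

/-- An injection respecting the colours is an independent choice of one injection per colour class,
and injections are counted by falling factorials. Only colours in the range of `s` need finite
classes: for the others the falling factorial of order `0` is `1`, whatever `toNat` returns. -/
lemma tsum_embedding_color {ι κ : Type*} [Fintype ι] [Fintype κ] [DecidableEq κ] (s : ι → κ)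
    (c : ℕ → κ) (hfin : ∀ j, {i | c i = s j}.Finite) :
    ∑' a : ι ↪ ℕ, Set.indicator {a : ι ↪ ℕ | ∀ j, c (a j) = s j} (1 : (ι ↪ ℕ) → ℝ≥0∞) a =
      ∏ S : κ, (({i | c i = S}.encard.toNat.descFactorial (Fintype.card {j // s j = S}) : ℕ) :
        ℝ≥0∞) := by
  have hfinite : ∀ S : κ, Finite ({j // s j = S} ↪ {i // c i = S}) := by
    intro S
    by_cases h : ∃ j, s j = S
    · obtain ⟨j, rfl⟩ := h
      have : Finite {i // c i = s j} := (hfin j).to_subtype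
      infer_instance
    · have : IsEmpty {j // s j = S} := ⟨fun j => h ⟨j.1, j.2⟩⟩
      infer_instance
  rw [← tsum_subtype]
  simp only [Pi.one_apply]
  rw [ENNReal.tsum_one]
  have e := embeddingColorEquiv s c
  have hf : Finite {a : ι ↪ ℕ // ∀ j, c (a j) = s j} := Finite.of_equiv _ e.symm
  have : ENat.card {a : ι ↪ ℕ // ∀ j, c (a j) = s j} =
      (Nat.card {a : ι ↪ ℕ // ∀ j, c (a j) = s j} : ℕ∞) := by
    have := Fintype.ofFinite {a : ι ↪ ℕ // ∀ j, c (a j) = s j}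
    rw [ENat.card_eq_coe_fintype_card, Nat.card_eq_fintype_card]
  change (((ENat.card {a : ι ↪ ℕ // ∀ j, c (a j) = s j}) : ℕ∞) : ℝ≥0∞) = _
  rw [this, Nat.card_congr e, Nat.card_pi, ENat.toENNReal_coe, Nat.cast_prod]
  refine Finset.prod_congr rfl fun S _ => ?_
  congr 1
  by_cases h : ∃ j, s j = S
  · obtain ⟨j, rfl⟩ := h
    have : Fintype {i // c i = s j} := (hfin j).fintype
    rw [Nat.card_eq_fintype_card, Fintype.card_embedding_eq]
    congr 1
    rw [← Set.ncard, ← Nat.card_coe_set_eq, ← Nat.card_eq_fintype_card]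
    rfl
  · have : IsEmpty {j // s j = S} := ⟨fun j => h ⟨j.1, j.2⟩⟩
    simp

lemma measurable_encard_setOf_mem {Ω β : Type*} [MeasurableSpace Ω] [MeasurableSpace β]
    {Y : ℕ → Ω → β} (hY : ∀ i, Measurable (Y i)) {B : Set β} (hB : MeasurableSet B) :
    Measurable fun ω => Set.encard {i : ℕ | Y i ω ∈ B} := by
  have h : Measurable fun ω => ((Set.encard {i : ℕ | Y i ω ∈ B} : ℕ∞) : ℝ≥0∞) := by
    have : (fun ω => ((Set.encard {i : ℕ | Y i ω ∈ B} : ℕ∞) : ℝ≥0∞)) =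
        fun ω => ∑' i, B.indicator 1 (Y i ω) := by
      funext ω
      rw [← ENNReal.tsum_set_one, tsum_subtype {i : ℕ | Y i ω ∈ B} (fun _ => (1 : ℝ≥0∞))]
      rfl
    rw [this]
    exact Measurable.tsum fun i => (measurable_one.indicator hB).comp (hY i)
  refine measurable_to_countable' fun n => ?_
  have : (fun ω => Set.encard {i : ℕ | Y i ω ∈ B}) ⁻¹' {n} =
      (fun ω => ((Set.encard {i : ℕ | Y i ω ∈ B} : ℕ∞) : ℝ≥0∞)) ⁻¹' {(n : ℝ≥0∞)} := by
    ext ω; simp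
  rw [this]
  exact h (measurableSet_singleton _)

instance instCountableEmbedding {ι N : Type*} [Finite ι] [Countable N] : Countable (ι ↪ N) :=
  DFunLike.coe_injective.countable

namespace IsPoissonProcess

variable {Ω β : Type*} [MeasurableSpace Ω] [MeasurableSpace β] {P : Measure Ω}
  {μ : Measure β} {Y : ℕ → Ω → β}

lemma ae_finite (h : IsPoissonProcess P μ Y) {B : Set β} (hB : MeasurableSet B)
    (hfin : μ B ≠ ∞) : ∀ᵐ ω ∂P, {i : ℕ | Y i ω ∈ B}.Finite := by
  have hl := h.count_poisson B hB hfin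
  have h1 : ∀ᵐ x ∂((poissonMeasure (μ B).toNNReal).map (Nat.cast : ℕ → ℕ∞)), x ≠ ⊤ := by
    rw [ae_map_iff (by fun_prop) (MeasurableSet.of_discrete)]
    exact ae_of_all _ fun n => ENat.natCast_ne_top n
  rw [← hl.map_eq, ae_map_iff hl.aemeasurable (MeasurableSet.of_discrete)] at h1
  filter_upwards [h1] with ω hω
  exact Set.encard_ne_top_iff.1 hω

lemma lintegral_descFactorial (h : IsPoissonProcess P μ Y) {B : Set β} (hB : MeasurableSet B)
    (hfin : μ B ≠ ∞) (k : ℕ) :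
    ∫⁻ ω, ((Set.encard {i : ℕ | Y i ω ∈ B}).toNat.descFactorial k : ℝ≥0∞) ∂P = μ B ^ k := by
  have hl := h.count_poisson B hB hfin
  have : ∫⁻ ω, ((Set.encard {i : ℕ | Y i ω ∈ B}).toNat.descFactorial k : ℝ≥0∞) ∂P =
      ∫⁻ x, (x.toNat.descFactorial k : ℝ≥0∞) ∂(P.map fun ω => Set.encard {i : ℕ | Y i ω ∈ B}) := by
    rw [lintegral_map' (Measurable.of_discrete (f := fun x : ℕ∞ =>
      (x.toNat.descFactorial k : ℝ≥0∞))).aemeasurable hl.aemeasurable]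
  rw [this, hl.map_eq, lintegral_map .of_discrete .of_discrete]
  simp only [ENat.toNat_natCast]
  rw [lintegral_descFactorial_poissonMeasure, ENNReal.coe_toNNReal hfin]

lemma indep_of_fintype (h : IsPoissonProcess P μ Y) {κ : Type*} [Fintype κ] {B : κ → Set β}
    (hB : ∀ S, MeasurableSet (B S)) (hd : Pairwise fun S T => Disjoint (B S) (B T)) :
    iIndepFun (fun S ω => Set.encard {i : ℕ | Y i ω ∈ B S}) P := by
  let e := Fintype.equivFin κ
  have h1 := h.count_indep _ (fun j => B (e.symm j)) (fun j => hB _)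
    (fun i j hij => hd (e.symm.injective.ne hij))
  have h2 := h1.precomp (g := e) e.injective
  simpa using h2

/-- The factorial moment measure of order `ι`. -/
noncomputable def momentMeasure (P : Measure Ω) (Y : ℕ → Ω → β) (ι : Type*) [Fintype ι] :
    Measure (ι → β) :=
  Measure.sum fun a : ι ↪ ℕ => P.map fun ω j => Y (a j) ω

/-- The colour classes are disjoint, so their counts are independent Poisson variables, and the
expected product of falling factorials is a product of powers of masses. -/
lemma momentMeasure_color (h : IsPoissonProcess P μ Y) {ι κ : Type*} [Fintype ι] [Fintype κ]
    [MeasurableSpace κ] [MeasurableSingletonClass κ] [DecidableEq κ] (c : β → κ)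
    (hc : Measurable c) (s : ι → κ) (hs : ∀ j, μ (c ⁻¹' {s j}) ≠ ∞) :
    momentMeasure P Y ι {x | ∀ j, c (x j) = s j} = ∏ j, μ (c ⁻¹' {s j}) := by
  have hm : MeasurableSet {x : ι → β | ∀ j, c (x j) = s j} := by
    have : {x : ι → β | ∀ j, c (x j) = s j} = Set.univ.pi fun j => c ⁻¹' {s j} := by
      ext; simp
    rw [this]
    exact MeasurableSet.univ_pi fun j => hc (measurableSet_singleton _)
  have hcm : ∀ S : κ, MeasurableSet (c ⁻¹' {S}) := fun S => hc (measurableSet_singleton _)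
  have hY := h.measurable
  rw [momentMeasure, Measure.sum_apply _ hm]
  have h1 : ∀ a : ι ↪ ℕ, P.map (fun ω j => Y (a j) ω) {x | ∀ j, c (x j) = s j} =
      ∫⁻ ω, Set.indicator {a : ι ↪ ℕ | ∀ j, c (Y (a j) ω) = s j} 1 a ∂P := by
    intro a
    have hma : Measurable fun ω j => Y (a j) ω := measurable_pi_lambda _ fun j => hY _
    rw [Measure.map_apply hma hm, ← lintegral_indicator_one (hma hm)]
    rfl
  simp_rw [h1]
  rw [← lintegral_tsum]
  swap
  · intro a
    have hma : Measurable fun ω j => Y (a j) ω := measurable_pi_lambda _ fun j => hY _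
    exact ((measurable_const (a := (1 : ℝ≥0∞))).indicator (hma hm)).aemeasurable
  have h2 : ∫⁻ ω, ∑' a : ι ↪ ℕ, Set.indicator {a : ι ↪ ℕ | ∀ j, c (Y (a j) ω) = s j} 1 a ∂P =
      ∫⁻ ω, ∏ S : κ, (((Set.encard {i : ℕ | Y i ω ∈ c ⁻¹' {S}}).toNat.descFactorial
        (Fintype.card {j // s j = S}) : ℕ) : ℝ≥0∞) ∂P := by
    refine lintegral_congr_ae ?_
    filter_upwards [ae_all_iff.2 fun j => h.ae_finite (hcm (s j)) (hs j)] with ω hω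
    exact tsum_embedding_color s (fun i => c (Y i ω)) hω
  rw [h2]
  have hind := h.indep_of_fintype hcm (fun S T hST => by
    refine Set.disjoint_left.2 ?_; rintro x rfl h2; exact hST h2)
  have hind2 := hind.comp (fun S (x : ℕ∞) =>
    ((x.toNat.descFactorial (Fintype.card {j // s j = S}) : ℕ) : ℝ≥0∞)) (fun S => .of_discrete)
  have h3 := lintegral_prod_eq_prod_lintegral_of_indepFun Finset.univ _ hind2 (fun S =>
    (Measurable.of_discrete).comp (measurable_encard_setOf_mem hY (hcm S)))
  simp only [Function.comp] at h3
  rw [h3]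
  have h4 : ∀ S : κ, ∫⁻ ω, ((Set.encard {i : ℕ | Y i ω ∈ c ⁻¹' {S}}).toNat.descFactorial
      (Fintype.card {j // s j = S}) : ℝ≥0∞) ∂P =
      μ (c ⁻¹' {S}) ^ (Fintype.card {j // s j = S}) := by
    intro S
    have := hind.isProbabilityMeasure
    by_cases hS : ∃ j, s j = S
    · obtain ⟨j, rfl⟩ := hS
      exact h.lintegral_descFactorial (hcm _) (hs j) _
    · have : IsEmpty {j // s j = S} := ⟨fun j => hS ⟨j.1, j.2⟩⟩
      simp
  rw [Finset.prod_congr rfl fun S _ => h4 S]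
  rw [← Finset.prod_fiberwise' Finset.univ s (fun S => μ (c ⁻¹' {S}))]
  refine Finset.prod_congr rfl fun S _ => ?_
  rw [Finset.prod_const, Fintype.card_subtype]

/-- The factorial moment measures of a Poisson process are the powers of the intensity measure. -/
theorem momentMeasure_eq (h : IsPoissonProcess P μ Y) [SigmaFinite μ] (ι : Type*) [Fintype ι] :
    momentMeasure P Y ι = Measure.pi fun _ => μ := by
  classical
  symm
  have hC : MeasurableSpace.generateFrom {B : Set β | MeasurableSet B ∧ μ B ≠ ∞} =
      ‹MeasurableSpace β› := by
    refine le_antisymm (MeasurableSpace.generateFrom_le fun B hB => hB.1) fun B hB => ?_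
    rw [← Set.inter_univ B, ← iUnion_spanningSets μ, Set.inter_iUnion]
    refine MeasurableSet.iUnion fun n => MeasurableSpace.measurableSet_generateFrom ⟨?_, ?_⟩
    · exact hB.inter (measurableSet_spanningSets μ n)
    · exact ((measure_mono Set.inter_subset_right).trans_lt (measure_spanningSets_lt_top μ n)).ne
  refine Measure.pi_eq_generateFrom (C := fun _ => {B : Set β | MeasurableSet B ∧ μ B ≠ ∞})
    (fun _ => hC) (fun _ => ?_) (fun _ => ⟨spanningSets μ, fun n => ⟨measurableSet_spanningSets μ n,
      (measure_spanningSets_lt_top μ n).ne⟩, measure_spanningSets_lt_top μ,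
        iUnion_spanningSets μ⟩) ?_
  · rintro A ⟨hA, hA'⟩ B ⟨hB, _⟩ _
    exact ⟨hA.inter hB, ((measure_mono Set.inter_subset_left).trans_lt hA'.lt_top).ne⟩
  intro B hB
  let mk : MeasurableSpace (Finset ι) := ⊤
  have : DiscreteMeasurableSpace (Finset ι) := ⟨fun _ => trivial⟩
  -- The sides `B j` may overlap, whereas independence is available only for disjoint sets.
  -- Colouring a point by the set of all `j` with `x ∈ B j` passes to the atoms they generate; the
  -- box is a disjoint union of colour patterns, and the product of the `μ (B j)` expands
  -- accordingly.
  let c : β → Finset ι := fun x => Finset.univ.filter fun j => x ∈ B j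
  have hc : Measurable c := by
    refine measurable_to_countable' fun S => ?_
    have : c ⁻¹' {S} = ⋂ j, (if j ∈ S then B j else (B j)ᶜ) := by
      ext x
      simp only [Set.mem_preimage, Set.mem_singleton_iff, Finset.ext_iff, c, Finset.mem_filter,
        Finset.mem_univ, true_and, Set.mem_iInter]
      refine forall_congr' fun j => ?_
      split_ifs with hj <;> simp [hj]
    rw [this]
    refine MeasurableSet.iInter fun j => ?_
    split_ifs
    exacts [(hB j).1, (hB j).1.compl]
  have hsub : ∀ j, ∀ S : Finset ι, j ∈ S → c ⁻¹' {S} ⊆ B j := by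
    intro j S hj x hx
    have : j ∈ c x := by rw [Set.mem_preimage.1 hx]; exact hj
    simpa [c] using this
  have hsplit : ∀ j, μ (B j) = ∑ S ∈ Finset.univ.filter (fun S : Finset ι => j ∈ S),
      μ (c ⁻¹' {S}) := by
    intro j
    rw [← measure_biUnion_finset (fun S _ T _ hST => by
        rw [Function.onFun, Set.disjoint_left]; rintro x rfl h2; exact hST h2)
      (fun S _ => hc (measurableSet_singleton _))]
    congr 1
    ext x
    simp [c]
  have hset : Set.univ.pi B = ⋃ s ∈ Fintype.piFinset fun j : ι =>
      Finset.univ.filter (fun S : Finset ι => j ∈ S), {x : ι → β | ∀ j, c (x j) = s j} := by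
    ext x
    simp only [Set.mem_pi, Set.mem_univ, true_implies, Set.mem_iUnion, Fintype.mem_piFinset,
      Finset.mem_filter, Finset.mem_univ, true_and, Set.mem_ofPred_eq, exists_prop]
    constructor
    · intro hx
      exact ⟨fun j => c (x j), fun j => by simp [c, hx j], fun j => rfl⟩
    · rintro ⟨s, hs, hx⟩ j
      exact hsub j (s j) (hs j) (hx j)
  rw [hset, measure_biUnion_finset]
  · rw [Finset.prod_congr rfl fun j _ => hsplit j, Finset.prod_univ_sum]
    refine Finset.sum_congr rfl fun s hs => ?_
    simp only [Fintype.mem_piFinset, Finset.mem_filter, Finset.mem_univ, true_and] at hs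
    exact h.momentMeasure_color c hc s fun j =>
      ((measure_mono (hsub j _ (hs j))).trans_lt (hB j).2.lt_top).ne
  · intro s _ s' _ hss
    rw [Function.onFun, Set.disjoint_left]
    intro x hx hx'
    exact hss (funext fun j => (hx j).symm.trans (hx' j))
  · intro s _
    have : {x : ι → β | ∀ j, c (x j) = s j} = Set.univ.pi fun j => c ⁻¹' {s j} := by
      ext; simp
    rw [this]
    exact MeasurableSet.univ_pi fun j => hc (measurableSet_singleton _)

lemma lintegral_tsum_embedding (h : IsPoissonProcess P μ Y) [SigmaFinite μ] {ι : Type*} [Fintype ι]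
    {g : (ι → β) → ℝ≥0∞} (hg : Measurable g) :
    ∫⁻ ω, ∑' a : ι ↪ ℕ, g (fun j => Y (a j) ω) ∂P = ∫⁻ x, g x ∂(Measure.pi fun _ => μ) := by
  have hY := h.measurable
  have hma : ∀ a : ι ↪ ℕ, Measurable fun ω j => Y (a j) ω :=
    fun a => measurable_pi_lambda _ fun j => hY _
  rw [← h.momentMeasure_eq ι, momentMeasure, lintegral_sum_measure, lintegral_tsum]
  · exact tsum_congr fun a => (lintegral_map hg (hma a)).symm
  · exact fun a => (hg.comp (hma a)).aemeasurable

/-- Almost surely, no tuple of distinct points lies in a given null set. -/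
lemma ae_forall_embedding_notMem (h : IsPoissonProcess P μ Y) [SigmaFinite μ] {ι : Type*}
    [Fintype ι] {S : Set (ι → β)} (hS : (Measure.pi fun _ : ι => μ) S = 0) :
    ∀ᵐ ω ∂P, ∀ a : ι ↪ ℕ, (fun j => Y (a j) ω) ∉ S := by
  have hY := h.measurable
  have hma : ∀ a : ι ↪ ℕ, Measurable fun ω j => Y (a j) ω :=
    fun a => measurable_pi_lambda _ fun j => hY _
  rw [← h.momentMeasure_eq ι, momentMeasure, Measure.sum_apply_eq_zero] at hS
  exact ae_all_iff.2 fun a =>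
    measure_eq_zero_iff_ae_notMem.1 (Measure.preimage_null_of_map_null (hma a).aemeasurable (hS a))

end IsPoissonProcess

/-! ### Characteristic functional of a Poisson process. -/

namespace IsPoissonProcess

variable {Ω β : Type*} [MeasurableSpace Ω] [MeasurableSpace β] {P : Measure Ω}
  {μ : Measure β} {Y : ℕ → Ω → β}

lemma integral_cexp_encard (h : IsPoissonProcess P μ Y) {B : Set β} (hB : MeasurableSet B)
    (hfin : μ B ≠ ∞) (c : ℝ) :
    ∫ ω, Complex.exp (c * (Set.encard {i : ℕ | Y i ω ∈ B}).toNat * Complex.I) ∂P =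
      Complex.exp (μ.real B * (Complex.exp (c * Complex.I) - 1)) := by
  have hl := h.count_poisson B hB hfin
  have h1 := charFun_map_cast_poissonMeasure (μ B).toNNReal c
  rw [charFun_apply_real, integral_map .of_discrete (by fun_prop)] at h1
  have h2 : ∫ ω, Complex.exp (c * (Set.encard {i : ℕ | Y i ω ∈ B}).toNat * Complex.I) ∂P =
      ∫ x, Complex.exp (c * (x.toNat : ℂ) * Complex.I)
        ∂(P.map fun ω => Set.encard {i : ℕ | Y i ω ∈ B}) := by
    rw [integral_map hl.aemeasurable (Measurable.of_discrete.aestronglyMeasurable)]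
  rw [h2, hl.map_eq, integral_map .of_discrete (Measurable.of_discrete.aestronglyMeasurable)]
  simp only [ENat.toNat_natCast]
  change _ = Complex.exp ((((μ B).toNNReal : ℝ) : ℂ) * _)
  simpa using h1

lemma tsum_eq_sum_count {f : SimpleFunc β ℝ} {y : ℕ → β}
    (hfin : {i | f (y i) ≠ 0}.Finite) :
    ∑' i, f (y i) = ∑ c ∈ f.range, c * ({i | y i ∈ f ⁻¹' {c}}.encard.toNat : ℝ) := by
  classical
  rw [tsum_eq_sum (s := hfin.toFinset) (fun i hi => by simpa using hi)]
  rw [← Finset.sum_fiberwise_of_maps_to (t := f.range) (g := fun i => f (y i))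
    (fun i _ => SimpleFunc.mem_range_self f (y i))]
  refine Finset.sum_congr rfl fun c _ => ?_
  rw [Finset.sum_congr rfl (g := fun _ => c) (fun i hi => (Finset.mem_filter.1 hi).2),
    Finset.sum_const, nsmul_eq_mul, mul_comm]
  by_cases hc : c = 0
  · simp [hc]
  have : {i | y i ∈ f ⁻¹' {c}} = ↑(hfin.toFinset.filter fun i => f (y i) = c) := by
    ext i
    simp only [Finset.coe_filter, Set.Finite.mem_toFinset, Set.mem_ofPred_eq, Set.mem_preimage,
      Set.mem_singleton_iff]
    exact ⟨fun h => ⟨h ▸ hc, h⟩, And.right⟩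
  rw [this, Set.encard_coe_eq_coe_finsetCard, ENat.toNat_natCast]

/-- For a simple function the sum is a combination of independent Poisson counts of its fibres, so
the expectation factorises. -/
lemma integral_cexp_tsum_simpleFunc (h : IsPoissonProcess P μ Y) {A : Set β}
    (hA : MeasurableSet A) (hfin : μ A ≠ ∞) (f : SimpleFunc β ℝ) (hf : ∀ x ∉ A, f x = 0) :
    ∫ ω, Complex.exp ((∑' i, f (Y i ω) : ℝ) * Complex.I) ∂P =
      Complex.exp (∫ x, (Complex.exp (f x * Complex.I) - 1) ∂μ) := by
  classical
  have hsub : ∀ c : ℝ, c ≠ 0 → f ⁻¹' {c} ⊆ A := by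
    intro c hc x hx
    by_contra hxA
    exact hc (by rw [← hf x hxA]; exact hx.symm)
  have hfc : ∀ c : ℝ, c ≠ 0 → μ (f ⁻¹' {c}) ≠ ∞ := fun c hc =>
    ((measure_mono (hsub c hc)).trans_lt hfin.lt_top).ne
  have hind := h.indep_of_fintype (κ := f.range) (B := fun c => f ⁻¹' {c.1})
    (fun c => f.measurableSet_fiber c.1) (fun c c' hcc => Set.disjoint_left.2 (by
      intro x hx hx'
      exact hcc (Subtype.ext (hx.symm.trans hx'))))
  have hP := hind.isProbabilityMeasure
  have h1 := hind.integral_fun_prod_comp (𝕜 := ℂ)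
    (f := fun c x => Complex.exp ((c.1 : ℝ) * (x.toNat : ℂ) * Complex.I))
    (fun c => (measurable_encard_setOf_mem h.measurable (f.measurableSet_fiber c.1)).aemeasurable)
    (fun c => Measurable.of_discrete.aestronglyMeasurable)
  have h2 : ∀ c : f.range, ∫ ω, Complex.exp ((c.1 : ℝ) *
      ((Set.encard {i : ℕ | Y i ω ∈ f ⁻¹' {c.1}}).toNat : ℂ) * Complex.I) ∂P =
      Complex.exp (μ.real (f ⁻¹' {c.1}) * (Complex.exp (c.1 * Complex.I) - 1)) := by
    intro c
    -- The zero fibre may have infinite mass, but its factor is `1` on both sides.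
    by_cases hc : c.1 = 0
    · simp [hc]
    · exact h.integral_cexp_encard (f.measurableSet_fiber c.1) (hfc _ hc) c.1
  have h3 : ∫ ω, Complex.exp ((∑' i, f (Y i ω) : ℝ) * Complex.I) ∂P =
      ∫ ω, ∏ c : f.range, Complex.exp ((c.1 : ℝ) *
        ((Set.encard {i : ℕ | Y i ω ∈ f ⁻¹' {c.1}}).toNat : ℂ) * Complex.I) ∂P := by
    refine integral_congr_ae ?_
    filter_upwards [h.ae_finite hA hfin] with ω hω
    have : {i | f (Y i ω) ≠ 0}.Finite := hω.subset fun i hi => by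
      by_contra hi'
      exact hi (hf _ hi')
    rw [tsum_eq_sum_count this, ← Complex.exp_sum]
    congr 1
    rw [← Finset.sum_mul, ← Finset.sum_coe_sort f.range]
    push_cast
    rfl
  rw [h3, h1, Finset.prod_congr rfl fun c _ => h2 c, ← Complex.exp_sum]
  congr 1
  have h4 : ∀ x, Complex.exp (f x * Complex.I) - 1 = ∑ c : f.range,
      (f ⁻¹' {c.1}).indicator (fun _ => Complex.exp (c.1 * Complex.I) - 1) x := by
    intro x
    rw [Finset.sum_eq_single ⟨f x, SimpleFunc.mem_range_self f x⟩]
    · rw [Set.indicator_of_mem]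
      simp
    · intro c _ hc
      rw [Set.indicator_of_notMem]
      intro hx
      exact hc (Subtype.ext hx.symm)
    · simp
  simp_rw [h4]
  rw [integral_finsetSum]
  · refine Finset.sum_congr rfl fun c _ => ?_
    rw [integral_indicator_const _ (f.measurableSet_fiber c.1), Complex.real_smul]
  · intro c _
    by_cases hc : c.1 = 0
    · simp [hc]
    · exact (integrable_indicator_iff (f.measurableSet_fiber c.1)).2
        (integrableOn_const (hfc _ hc))

/-- The characteristic functional of a Poisson process. -/
theorem integral_cexp_tsum (h : IsPoissonProcess P μ Y) {A : Set β}
    (hA : MeasurableSet A) (hfin : μ A ≠ ∞) {f : β → ℝ} (hm : Measurable f)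
    (hf : ∀ x ∉ A, f x = 0) :
    ∫ ω, Complex.exp ((∑' i, f (Y i ω) : ℝ) * Complex.I) ∂P =
      Complex.exp (∫ x, (Complex.exp (f x * Complex.I) - 1) ∂μ) := by
  have hP : IsProbabilityMeasure P :=
    (h.count_indep 0 (fun _ => ∅) (fun _ => .empty) (fun i => i.elim0)).isProbabilityMeasure
  -- Restricting the approximants to `A` leaves finitely many nonzero terms almost surely, and gives
  -- the integrable bound `2 · 1_A` for the exponents.
  let F : ℕ → SimpleFunc β ℝ := fun n => (hm.stronglyMeasurable.approx n).restrict A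
  have hF0 : ∀ n, ∀ x ∉ A, F n x = 0 := by
    intro n x hx
    simp [F, SimpleFunc.restrict_apply _ hA, hx]
  have hFlim : ∀ x, Tendsto (fun n => F n x) atTop (nhds (f x)) := by
    intro x
    by_cases hx : x ∈ A
    · simpa [F, SimpleFunc.restrict_apply _ hA, hx] using hm.stronglyMeasurable.tendsto_approx x
    · simp only [hF0 _ x hx, hf x hx]
      exact tendsto_const_nhds
  have hnorm : ∀ a : ℝ, ‖Complex.exp (a * Complex.I)‖ = 1 := Complex.norm_exp_ofReal_mul_I
  have hcont : Continuous fun a : ℝ => Complex.exp (a * Complex.I) := by fun_prop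
  have hsum : ∀ (g : β → ℝ), (∀ x ∉ A, g x = 0) → ∀ ω (hω : {i : ℕ | Y i ω ∈ A}.Finite),
      ∑' i, g (Y i ω) = ∑ i ∈ hω.toFinset, g (Y i ω) := fun g hg ω hω =>
    tsum_eq_sum fun i hi => hg _ (by simpa using hi)
  have hL : Tendsto (fun n => ∫ ω, Complex.exp ((∑' i, F n (Y i ω) : ℝ) * Complex.I) ∂P) atTop
      (nhds (∫ ω, Complex.exp ((∑' i, f (Y i ω) : ℝ) * Complex.I) ∂P)) := by
    refine tendsto_integral_of_dominated_convergence (fun _ => 1) (fun n => ?_)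
      (integrable_const _) (fun n => ae_of_all _ fun ω => (hnorm _).le) ?_
    · have : Measurable fun ω => ∑' i, F n (Y i ω) :=
        Measurable.tsum fun i => (F n).measurable.comp (h.measurable i)
      exact (hcont.measurable.comp this).aestronglyMeasurable
    · filter_upwards [h.ae_finite hA hfin] with ω hω
      refine (hcont.tendsto _).comp ?_
      simp_rw [fun n => hsum (F n) (hF0 n) ω hω, hsum f hf ω hω]
      exact tendsto_finsetSum _ fun i _ => hFlim _
  have hR : Tendsto (fun n => Complex.exp (∫ x, (Complex.exp (F n x * Complex.I) - 1) ∂μ)) atTop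
      (nhds (Complex.exp (∫ x, (Complex.exp (f x * Complex.I) - 1) ∂μ))) := by
    refine (Complex.continuous_exp.tendsto _).comp ?_
    refine tendsto_integral_of_dominated_convergence (A.indicator fun _ => 2) (fun n => ?_)
      ((integrable_indicator_iff hA).2 (integrableOn_const hfin)) (fun n => ae_of_all _ fun x => ?_)
      (ae_of_all _ fun x => ?_)
    · exact ((hcont.measurable.comp (F n).measurable).sub_const 1).aestronglyMeasurable
    · by_cases hx : x ∈ A
      · rw [Set.indicator_of_mem hx]
        refine (norm_sub_le _ _).trans ?_
        rw [hnorm, norm_one]; norm_num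
      · simp [hF0 n x hx, hx]
    · exact ((hcont.tendsto _).comp (hFlim x)).sub_const 1
  refine tendsto_nhds_unique hL ?_
  simp_rw [fun n => h.integral_cexp_tsum_simpleFunc hA hfin (F n) (hF0 n)]
  exact hR

end IsPoissonProcess

/-! ### Central limit theorem for linear statistics. -/

lemma norm_exp_mul_I_taylor {x C : ℝ} (hx : |x| ≤ C) (hC : C ≤ 1) :
    ‖Complex.exp (x * Complex.I) - 1 - x * Complex.I + x ^ 2 / 2‖ ≤ C ^ 3 := by
  have hn : ‖(x : ℂ) * Complex.I‖ = |x| := by simp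
  have h := Complex.exp_bound (x := x * Complex.I) (by rw [hn]; exact hx.trans hC) (n := 3)
    (by norm_num)
  rw [hn] at h
  simp only [Finset.sum_range_succ, Finset.sum_range_zero] at h
  have e : Complex.exp (x * Complex.I) - 1 - x * Complex.I + x ^ 2 / 2 =
      Complex.exp (x * Complex.I) - (0 + (x * Complex.I) ^ 0 / (0 ! : ℕ) +
        (x * Complex.I) ^ 1 / (1 ! : ℕ) + (x * Complex.I) ^ 2 / (2 ! : ℕ)) := by
    rw [mul_pow _ _ 2, Complex.I_sq]
    simp [Nat.factorial]
    ring
  rw [e]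
  refine h.trans ?_
  have h3 : |x| ^ 3 ≤ C ^ 3 := pow_le_pow_left₀ (abs_nonneg _) hx 3
  have : (0 : ℝ) ≤ |x| ^ 3 := by positivity
  simp [Nat.factorial]
  nlinarith

/-- Central limit theorem for the sum of a bounded function over the points of a Poisson process
with growing intensity. -/
theorem tendstoInDistribution_tsum {Ω β κ : Type*} [MeasurableSpace Ω] [MeasurableSpace β]
    {P : Measure Ω} [IsProbabilityMeasure P] {l : Filter κ} [l.IsCountablyGenerated]
    {Q : Measure β} [IsProbabilityMeasure Q] {μ : κ → Measure β} {Y : κ → ℕ → Ω → β} {t : κ → ℝ}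
    (ht : Tendsto t l atTop) (hmeas : ∀ r i, Measurable (Y r i))
    (hY : ∀ᶠ r in l, IsPoissonProcess P (μ r) (Y r)) {A : Set β} (hA : MeasurableSet A)
    (hμ : ∀ᶠ r in l, (μ r).restrict A = ENNReal.ofReal (t r) • Q)
    {f : β → ℝ} (hf : Measurable f) {C : ℝ} (hC : ∀ x, |f x| ≤ C) (hf0 : ∀ x ∉ A, f x = 0)
    {v : ℝ≥0} (hv : ∫ x, f x ^ 2 ∂Q = v) :
    TendstoInDistribution
      (fun r ω => (∑' i, f (Y r i ω) - t r * ∫ x, f x ∂Q) / √(t r)) l id (fun _ => P)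
      (gaussianReal 0 v) := by
  have hC0 : 0 ≤ C := by
    obtain ⟨x⟩ := Measure.nonempty_of_neZero Q
    exact (abs_nonneg _).trans (hC x)
  have hsm : ∀ r, Measurable fun ω => ∑' i, f (Y r i ω) := fun r =>
    Measurable.tsum fun i => hf.comp (hmeas r i)
  have haem : ∀ r, AEMeasurable
      (fun ω => (∑' i, f (Y r i ω) - t r * ∫ x, f x ∂Q) / √(t r)) P := fun r =>
    (((hsm r).sub_const _).div_const _).aemeasurable
  have hfi : Integrable f Q := Integrable.of_bound hf.aestronglyMeasurable C (ae_of_all _ hC)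
  have hfi2 : Integrable (fun x => f x ^ 2) Q :=
    Integrable.of_bound (hf.pow_const 2).aestronglyMeasurable (C ^ 2) (ae_of_all _ fun x => by
      rw [Real.norm_eq_abs, abs_pow]; exact pow_le_pow_left₀ (abs_nonneg _) (hC x) 2)
  refine ⟨haem, by fun_prop, ?_⟩
  -- The continuity theorem for characteristic functions is applied along sequences, which suffices
  -- because `l` is countably generated.
  refine tendsto_of_seq_tendsto fun r hr => ?_
  refine ProbabilityMeasure.tendsto_iff_tendsto_charFun.2 fun u => ?_
  have htr := ht.comp hr
  -- In the exponent the linear Taylor term cancels the centring, and the quadratic term is exactly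
  -- `-u² v / 2`; only the third-order remainder depends on `n`.
  have hev : ∀ᶠ n in atTop, charFun (P.map fun ω =>
      (∑' i, f (Y (r n) i ω) - t (r n) * ∫ x, f x ∂Q) / √(t (r n))) u =
      Complex.exp (t (r n) * (∫ x, (Complex.exp ((u / √(t (r n)) * f x : ℝ) * Complex.I) - 1 -
        (u / √(t (r n)) * f x : ℝ) * Complex.I +
        ((u / √(t (r n)) * f x : ℝ) : ℂ) ^ 2 / 2) ∂Q) - u ^ 2 / 2 * v) := by
    filter_upwards [hr.eventually hY, hr.eventually hμ, htr.eventually_gt_atTop 0] with n h1 h2 h3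
    simp only [Function.comp_apply] at h3
    set τ := t (r n) with hτ
    set s : ℝ := u / √τ with hs
    have hsq : √τ * √τ = τ := Real.mul_self_sqrt h3.le
    have hsq0 : √τ ≠ 0 := (Real.sqrt_pos.2 h3).ne'
    have hfinA : μ (r n) A ≠ ∞ := by
      have := congrArg (fun m : Measure β => m Set.univ) h2
      simp only [Measure.restrict_apply_univ, Measure.smul_apply, measure_univ, smul_eq_mul,
        mul_one] at this
      rw [this]; exact ENNReal.ofReal_ne_top
    have key := h1.integral_cexp_tsum hA hfinA (f := fun x => s * f x) (hf.const_mul s)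
      (fun x hx => by simp [hf0 x hx])
    have hR : ∫ x, (Complex.exp ((s * f x : ℝ) * Complex.I) - 1) ∂(μ (r n)) =
        τ * ∫ x, (Complex.exp ((s * f x : ℝ) * Complex.I) - 1) ∂Q := by
      rw [← setIntegral_eq_integral_of_forall_compl_eq_zero (s := A)
        (fun x hx => by simp [hf0 x hx]), h2, integral_smul_measure, ENNReal.toReal_ofReal h3.le,
        Complex.real_smul]
    rw [hR] at key
    rw [charFun_apply_real, integral_map (haem _) (by fun_prop)]
    have e1 : ∀ ω, Complex.exp (u * ((∑' i, f (Y (r n) i ω) - τ * ∫ x, f x ∂Q) / √τ : ℝ) *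
        Complex.I) = Complex.exp ((∑' i, s * f (Y (r n) i ω) : ℝ) * Complex.I) *
          Complex.exp (-(τ * (s * ∫ x, f x ∂Q) : ℝ) * Complex.I) := by
      intro ω
      rw [← Complex.exp_add, tsum_mul_left]
      congr 1
      rw [hs]
      push_cast
      field_simp
      ring
    refine (integral_congr_ae (ae_of_all _ e1)).trans ?_
    rw [integral_mul_const, key, ← Complex.exp_add]
    congr 1
    have hi1 : Integrable (fun x => Complex.exp ((s * f x : ℝ) * Complex.I) - 1) Q := by
      refine Integrable.of_bound (C := 2) ?_ (ae_of_all _ fun x => ?_)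
      · exact (by fun_prop : Measurable fun x =>
          Complex.exp ((s * f x : ℝ) * Complex.I) - 1).aestronglyMeasurable
      · refine (norm_sub_le _ _).trans ?_
        rw [Complex.norm_exp_ofReal_mul_I, norm_one]; norm_num
    have hi2 : Integrable (fun x => ((s * f x : ℝ) : ℂ) * Complex.I) Q :=
      ((hfi.const_mul s).ofReal (𝕜 := ℂ)).mul_const _
    have hi3 : Integrable (fun x => ((s * f x : ℝ) : ℂ) ^ 2 / 2) Q := by
      have : Integrable (fun x => (((s ^ 2 * f x ^ 2) / 2 : ℝ) : ℂ)) Q :=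
        ((hfi2.const_mul (s ^ 2)).div_const 2).ofReal (𝕜 := ℂ)
      refine this.congr (ae_of_all _ fun x => ?_)
      push_cast; ring
    have hi12 : Integrable (fun x => Complex.exp ((s * f x : ℝ) * Complex.I) - 1 -
        ((s * f x : ℝ) : ℂ) * Complex.I) Q := hi1.sub hi2
    rw [integral_add hi12 hi3, integral_sub hi1 hi2]
    have e2 : ∫ x, ((s * f x : ℝ) : ℂ) * Complex.I ∂Q = (s * ∫ x, f x ∂Q : ℝ) * Complex.I := by
      rw [integral_mul_const, integral_complex_ofReal, integral_const_mul]
    have e3 : ∫ x, ((s * f x : ℝ) : ℂ) ^ 2 / 2 ∂Q = ((s ^ 2 / 2 * v : ℝ) : ℂ) := by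
      rw [← hv, ← integral_const_mul, ← integral_complex_ofReal]
      refine integral_congr_ae (ae_of_all _ fun x => ?_)
      dsimp only
      push_cast
      ring
    rw [e2, e3]
    have e4 : (τ : ℂ) * (s ^ 2 / 2 * v : ℝ) = (u : ℂ) ^ 2 / 2 * v := by
      have : τ * (s ^ 2 / 2 * v) = u ^ 2 / 2 * v := by
        rw [hs, div_pow, Real.sq_sqrt h3.le]
        field_simp
      exact_mod_cast congrArg (fun z : ℝ => (z : ℂ)) this
    rw [mul_add, e4]
    push_cast
    ring
  have hlim : Tendsto (fun n => (t (r n) : ℂ) *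
      (∫ x, (Complex.exp ((u / √(t (r n)) * f x : ℝ) * Complex.I) - 1 -
        (u / √(t (r n)) * f x : ℝ) * Complex.I +
        ((u / √(t (r n)) * f x : ℝ) : ℂ) ^ 2 / 2) ∂Q)) atTop (nhds 0) := by
    have hsqrt : Tendsto (fun n => √(t (r n))) atTop atTop := Real.tendsto_sqrt_atTop.comp htr
    -- The cubic bound on the remainder times the intensity: `t (|u| C / √t)³ = (|u| C)³ / √t`.
    refine squeeze_zero_norm' (a := fun n => (|u| * C) ^ 3 / √(t (r n))) ?_
      (hsqrt.const_div_atTop _)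
    filter_upwards [htr.eventually_gt_atTop 0, hsqrt.eventually_ge_atTop (|u| * C)] with n h3 h4
    simp only [Function.comp_apply] at h3
    set τ := t (r n) with hτ
    have hs0 : 0 < √τ := Real.sqrt_pos.2 h3
    have hbd : ∀ x, |u / √τ * f x| ≤ |u| * C / √τ := by
      intro x
      rw [abs_mul, abs_div, abs_of_pos hs0, div_mul_eq_mul_div]
      gcongr
      exact hC x
    have h5 := norm_integral_le_of_norm_le_const (μ := Q) (ae_of_all _ fun x =>
      norm_exp_mul_I_taylor (hbd x) ((div_le_one hs0).2 h4))
    rw [norm_mul, Complex.norm_real, Real.norm_eq_abs, abs_of_pos h3]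
    refine (mul_le_mul_of_nonneg_left h5 h3.le).trans (le_of_eq ?_)
    rw [probReal_univ, mul_one, div_pow]
    have : √τ ^ 3 = τ * √τ := by rw [pow_succ, Real.sq_sqrt h3.le]
    rw [this]
    field_simp
  have hfinal := (Complex.continuous_exp.tendsto _).comp (hlim.sub_const ((u : ℂ) ^ 2 / 2 * v))
  have e : Complex.exp (0 - (u : ℂ) ^ 2 / 2 * v) = charFun ((gaussianReal 0 v).map id) u := by
    rw [Measure.map_id, charFun_gaussianReal]
    congr 1
    push_cast
    ring
  rw [e] at hfinal
  exact hfinal.congr' (hev.mono fun n hn => hn.symm)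

/-! ### Products of sums over tuples, sorted by coincidences of indices. -/

section Combinatorics

variable {β : Type*}

/-- The extra index either avoids the tuple, extending it to a longer injection, or equals exactly
one of its entries. -/
lemma tsum_embedding_mul_tsum {n : ℕ} (g : (Fin n → β) → ℝ≥0∞) (f : β → ℝ≥0∞) (y : ℕ → β) :
    (∑' a : Fin n ↪ ℕ, g fun j => y (a j)) * ∑' i, f (y i) =
      ∑' b : Fin (n + 1) ↪ ℕ, g (fun j => y (b j.succ)) * f (y (b 0)) +
        ∑ p, ∑' a : Fin n ↪ ℕ, g (fun j => y (a j)) * f (y (a p)) := by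
  rw [← ENNReal.tsum_mul_right]
  have h1 : ∀ a : Fin n ↪ ℕ, ∑' i, f (y i) =
      ∑' i : {i // i ∉ Set.range a}, f (y i) + ∑ p, f (y (a p)) := by
    intro a
    rw [← ENNReal.summable.tsum_add_tsum_compl (s := Set.range a) ENNReal.summable, add_comm]
    congr 1
    rw [tsum_range (g := a) (fun i => f (y i)) a.injective, tsum_fintype]
  have h2 : ∀ a : Fin n ↪ ℕ, g (fun j => y (a j)) * ∑' i, f (y i) =
      g (fun j => y (a j)) * ∑' i : {i // i ∉ Set.range a}, f (y i) +
        ∑ p, g (fun j => y (a j)) * f (y (a p)) := fun a => by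
    rw [h1 a, mul_add, Finset.mul_sum]
  rw [tsum_congr h2, ENNReal.tsum_add, Summable.tsum_finsetSum (fun _ _ => ENNReal.summable)]
  congr 1
  rw [← (Equiv.embeddingFinSucc n ℕ).symm.tsum_eq, ENNReal.tsum_sigma']
  refine tsum_congr fun a => ?_
  rw [← ENNReal.tsum_mul_left]
  refine tsum_congr fun i => ?_
  simp [Equiv.coe_embeddingFinSucc_symm]

lemma tsum_disjoint_pairs_le {n : ℕ} (g : (Fin n → β) → ℝ≥0∞) (y : ℕ → β) :
    ∑' x : (Fin n ↪ ℕ) × (Fin n ↪ ℕ),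
      Set.indicator {x : (Fin n ↪ ℕ) × (Fin n ↪ ℕ) | ∀ p q, x.1 p ≠ x.2 q}
        (fun x => g (fun j => y (x.1 j)) * g (fun j => y (x.2 j))) x ≤
      ∑' c : Fin n ⊕ Fin n ↪ ℕ, g (fun j => y (c (.inl j))) * g (fun j => y (c (.inr j))) := by
  rw [← tsum_subtype]
  let e : {x : (Fin n ↪ ℕ) × (Fin n ↪ ℕ) | ∀ p q, x.1 p ≠ x.2 q} → (Fin n ⊕ Fin n ↪ ℕ) := fun x =>
    ⟨Sum.elim x.1.1 x.1.2, x.1.1.injective.sumElim x.1.2.injective x.2⟩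
  have he : Function.Injective e := by
    rintro ⟨⟨a, b⟩, h⟩ ⟨⟨a', b'⟩, h'⟩ hab
    have h1 : ∀ z, e ⟨⟨a, b⟩, h⟩ z = e ⟨⟨a', b'⟩, h'⟩ z := fun z => by rw [hab]
    refine Subtype.ext (Prod.ext ?_ ?_)
    · ext j; exact h1 (.inl j)
    · ext j; exact h1 (.inr j)
  exact ENNReal.tsum_comp_le_tsum_of_injective he
    (fun c => g (fun j => y (c (.inl j))) * g (fun j => y (c (.inr j))))

/-- The second tuple is recovered from its entries other than `q`, because its entry at `q` is the
`p`-th entry of the first. The remaining entries are distinct and glue to one injection. -/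
lemma tsum_one_coincidence_le {n : ℕ} (g : (Fin (n + 1) → β) → ℝ≥0∞) (y : ℕ → β)
    (p q : Fin (n + 1)) :
    ∑' x : (Fin (n + 1) ↪ ℕ) × (Fin (n + 1) ↪ ℕ),
      Set.indicator {x : (Fin (n + 1) ↪ ℕ) × (Fin (n + 1) ↪ ℕ) |
          x.1 p = x.2 q ∧ ∀ p' q', q' ≠ q → x.1 p' ≠ x.2 q'}
        (fun x => g (fun j => y (x.1 j)) * g (fun j => y (x.2 j))) x ≤
      ∑' c : Fin (n + 1) ⊕ Fin n ↪ ℕ, g (fun j => y (c (.inl j))) *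
        g (q.insertNth (y (c (.inl p))) fun j => y (c (.inr j))) := by
  rw [← tsum_subtype]
  let e : {x : (Fin (n + 1) ↪ ℕ) × (Fin (n + 1) ↪ ℕ) |
      x.1 p = x.2 q ∧ ∀ p' q', q' ≠ q → x.1 p' ≠ x.2 q'} → (Fin (n + 1) ⊕ Fin n ↪ ℕ) := fun x =>
    ⟨Sum.elim x.1.1 (fun j => x.1.2 (q.succAbove j)), x.1.1.injective.sumElim
      (x.1.2.injective.comp (Fin.succAbove_right_injective))
      fun i j => x.2.2 _ _ (Fin.succAbove_ne q j)⟩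
  have he : Function.Injective e := by
    rintro ⟨⟨a, b⟩, h⟩ ⟨⟨a', b'⟩, h'⟩ hab
    have h1 : ∀ z, e ⟨⟨a, b⟩, h⟩ z = e ⟨⟨a', b'⟩, h'⟩ z := fun z => by rw [hab]
    have ha : ∀ j, a j = a' j := fun j => h1 (.inl j)
    refine Subtype.ext (Prod.ext ?_ ?_)
    · ext j; exact ha j
    · refine DFunLike.ext _ _ ?_
      refine q.forall_iff_succAbove.2 ⟨?_, fun j => h1 (.inr j)⟩
      exact h.1.symm.trans ((ha p).trans h'.1)
  refine le_trans (le_of_eq (tsum_congr fun x => ?_))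
    (ENNReal.tsum_comp_le_tsum_of_injective he (fun c => g (fun j => y (c (.inl j))) *
        g (q.insertNth (y (c (.inl p))) fun j => y (c (.inr j)))))
  congr 2
  refine (Fin.eq_insertNth_iff (α := fun _ => β)).2 ⟨?_, ?_⟩
  · exact congrArg y x.2.1.symm
  · rfl

/-- Such a pair is determined by the first tuple and by the second off `q` and `q'`, hence by `(n +
1) + (n - 1) = 2n` indices, all among the points in `A` when the summand is nonzero. -/
lemma tsum_two_coincidences_le {n : ℕ} (g : (Fin (n + 1) → β) → ℝ≥0∞) (y : ℕ → β)
    {C : ℝ≥0∞} (hC : ∀ x, g x ≤ C) {A : Set β} (hA : ∀ x, (∃ j, x j ∉ A) → g x = 0)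
    (hfin : {i | y i ∈ A}.Finite) (p q p' q' : Fin (n + 1)) (hq : q ≠ q') :
    ∑' x : (Fin (n + 1) ↪ ℕ) × (Fin (n + 1) ↪ ℕ),
      Set.indicator {x : (Fin (n + 1) ↪ ℕ) × (Fin (n + 1) ↪ ℕ) | x.1 p = x.2 q ∧ x.1 p' = x.2 q'}
        (fun x => g (fun j => y (x.1 j)) * g (fun j => y (x.2 j))) x ≤
      C ^ 2 * ({i | y i ∈ A}.encard.toNat : ℝ≥0∞) ^ (2 * n) := by
  classical
  set K := {i | y i ∈ A} with hK
  let T : Set ((Fin (n + 1) ↪ ℕ) × (Fin (n + 1) ↪ ℕ)) :=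
    {x | (x.1 p = x.2 q ∧ x.1 p' = x.2 q') ∧ (∀ j, x.1 j ∈ K) ∧ ∀ j, x.2 j ∈ K}
  have h1 : ∀ x : (Fin (n + 1) ↪ ℕ) × (Fin (n + 1) ↪ ℕ),
      Set.indicator {x : (Fin (n + 1) ↪ ℕ) × (Fin (n + 1) ↪ ℕ) | x.1 p = x.2 q ∧ x.1 p' = x.2 q'}
        (fun x => g (fun j => y (x.1 j)) * g (fun j => y (x.2 j))) x ≤
      T.indicator (fun _ => C ^ 2) x := by
    intro x
    by_cases hx : x ∈ T
    · rw [Set.indicator_of_mem hx, Set.indicator_of_mem (by exact hx.1), sq]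
      gcongr <;> exact hC _
    · rw [Set.indicator_of_notMem hx, nonpos_iff_eq_zero, Set.indicator_apply_eq_zero]
      intro hx'
      by_cases h2 : ∀ j, x.1 j ∈ K
      · have h3 : ∃ j, x.2 j ∉ K := by
          by_contra! h3
          exact hx ⟨hx', h2, h3⟩
        rw [hA _ h3, mul_zero]
      · push Not at h2
        rw [hA _ h2, zero_mul]
  refine (ENNReal.tsum_le_tsum h1).trans ?_
  rw [← tsum_subtype T (fun _ => C ^ 2), ENNReal.tsum_const, mul_comm]
  gcongr
  have : Fintype K := hfin.fintype
  let e : T → (Fin (n + 1) → K) × ({j // j ≠ q ∧ j ≠ q'} → K) := fun x =>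
    (fun j => ⟨x.1.1 j, x.2.2.1 j⟩, fun j => ⟨x.1.2 j, x.2.2.2 j⟩)
  have he : Function.Injective e := by
    rintro ⟨⟨a, b⟩, h⟩ ⟨⟨a', b'⟩, h'⟩ hab
    have ha : ∀ j, a j = a' j := fun j =>
      congrArg Subtype.val (congrFun (congrArg Prod.fst hab) j)
    refine Subtype.ext (Prod.ext ?_ ?_)
    · ext j; exact ha j
    · ext j
      by_cases h1 : j = q
      · subst h1; exact h.1.1.symm.trans ((ha p).trans h'.1.1)
      by_cases h2 : j = q'
      · subst h2; exact h.1.2.symm.trans ((ha p').trans h'.1.2)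
      · exact congrArg Subtype.val (congrFun (congrArg Prod.snd hab) ⟨j, h1, h2⟩)
  have hle := ENat.card_le_card_of_injective he
  have hc2 : Fintype.card {j : Fin (n + 1) // j ≠ q ∧ j ≠ q'} = n - 1 := by
    rw [Fintype.card_subtype]
    have : (Finset.univ.filter fun j : Fin (n + 1) => j ≠ q ∧ j ≠ q') =
        (Finset.univ.erase q).erase q' := by
      ext j; simp [and_comm]
    rw [this, Finset.card_erase_of_mem (by simp [hq.symm]), Finset.card_erase_of_mem (by simp)]
    simp
  have hn : 1 ≤ n := by
    by_contra hn
    have : n = 0 := by omega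
    subst this
    exact hq (Fin.ext (by omega))
  rw [ENat.card_eq_coe_fintype_card (α := _ × _), Fintype.card_prod, Fintype.card_fun, Fintype.card_fun, hc2,
    Fintype.card_fin, ← pow_add, show n + 1 + (n - 1) = 2 * n by omega] at hle
  have hcard : K.encard.toNat = Fintype.card K := by
    rw [← Set.ncard, ← Nat.card_coe_set_eq, Nat.card_eq_fintype_card]
  rw [hcard]
  exact_mod_cast hle

/-- The three terms bound the pairs of tuples with no, exactly one, and at least two common indices.
The last class is covered by the `(n + 1) ^ 4` choices of two coinciding positions, with overlaps,
so only an upper bound results; it is of lower order. -/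
lemma tsum_embedding_sq_le {n : ℕ} (g : (Fin (n + 1) → β) → ℝ≥0∞) (y : ℕ → β)
    {C : ℝ≥0∞} (hC : ∀ x, g x ≤ C) {A : Set β} (hA : ∀ x, (∃ j, x j ∉ A) → g x = 0)
    (hfin : {i | y i ∈ A}.Finite) :
    (∑' a : Fin (n + 1) ↪ ℕ, g fun j => y (a j)) ^ 2 ≤
      ∑' c : Fin (n + 1) ⊕ Fin (n + 1) ↪ ℕ,
          g (fun j => y (c (.inl j))) * g (fun j => y (c (.inr j))) +
        ∑ p : Fin (n + 1), ∑ q : Fin (n + 1), ∑' c : Fin (n + 1) ⊕ Fin n ↪ ℕ,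
          g (fun j => y (c (.inl j))) * g (q.insertNth (y (c (.inl p))) fun j => y (c (.inr j))) +
        (n + 1) ^ 4 * (C ^ 2 * ({i | y i ∈ A}.encard.toNat : ℝ≥0∞) ^ (2 * n)) := by
  classical
  set H : (Fin (n + 1) ↪ ℕ) × (Fin (n + 1) ↪ ℕ) → ℝ≥0∞ :=
    fun x => g (fun j => y (x.1 j)) * g (fun j => y (x.2 j)) with hH
  let T (z : (Fin (n + 1) × Fin (n + 1)) × Fin (n + 1) × Fin (n + 1)) :
      Set ((Fin (n + 1) ↪ ℕ) × (Fin (n + 1) ↪ ℕ)) :=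
    {x | x.1 z.1.1 = x.2 z.1.2 ∧ x.1 z.2.1 = x.2 z.2.2}
  have h0 : (∑' a : Fin (n + 1) ↪ ℕ, g fun j => y (a j)) ^ 2 = ∑' x, H x := by
    rw [sq, ← ENNReal.tsum_mul_right]
    simp_rw [← ENNReal.tsum_mul_left]
    rw [ENNReal.tsum_prod']
  have h1 : ∀ x, H x ≤ Set.indicator {x : (Fin (n + 1) ↪ ℕ) × (Fin (n + 1) ↪ ℕ) |
        ∀ p q, x.1 p ≠ x.2 q} H x +
      ∑ p : Fin (n + 1), ∑ q : Fin (n + 1),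
        Set.indicator {x : (Fin (n + 1) ↪ ℕ) × (Fin (n + 1) ↪ ℕ) |
          x.1 p = x.2 q ∧ ∀ p' q', q' ≠ q → x.1 p' ≠ x.2 q'} H x +
      ∑ z, (if z.1.2 ≠ z.2.2 then (T z).indicator H x else 0) := by
    intro x
    by_cases hd : ∀ p q, x.1 p ≠ x.2 q
    · rw [Set.indicator_of_mem (by exact hd)]
      exact le_self_add.trans le_self_add
    push Not at hd
    obtain ⟨p, q, hpq⟩ := hd
    by_cases he : ∀ p' q', q' ≠ q → x.1 p' ≠ x.2 q'
    · refine le_trans ?_ (le_trans le_add_self le_self_add)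
      refine le_trans ?_ (Finset.single_le_sum (fun _ _ => zero_le) (Finset.mem_univ p))
      refine le_trans ?_ (Finset.single_le_sum (fun _ _ => zero_le) (Finset.mem_univ q))
      rw [Set.indicator_of_mem (by exact ⟨hpq, he⟩)]
    · push Not at he
      obtain ⟨p', q', hqq, hpq'⟩ := he
      refine le_trans ?_ le_add_self
      refine le_trans ?_ (Finset.single_le_sum (fun _ _ => zero_le)
        (Finset.mem_univ ((p, q), (p', q'))))
      rw [if_pos hqq.symm, Set.indicator_of_mem (by exact ⟨hpq, hpq'⟩)]
  rw [h0]
  refine (ENNReal.tsum_le_tsum h1).trans ?_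
  rw [ENNReal.tsum_add, ENNReal.tsum_add]
  refine add_le_add (add_le_add ?_ ?_) ?_
  · exact tsum_disjoint_pairs_le g y
  · rw [Summable.tsum_finsetSum (fun _ _ => ENNReal.summable)]
    refine Finset.sum_le_sum fun p _ => ?_
    rw [Summable.tsum_finsetSum (fun _ _ => ENNReal.summable)]
    exact Finset.sum_le_sum fun q _ => tsum_one_coincidence_le g y p q
  · rw [Summable.tsum_finsetSum (fun _ _ => ENNReal.summable)]
    refine (Finset.sum_le_card_nsmul _ _ (C ^ 2 * ({i | y i ∈ A}.encard.toNat : ℝ≥0∞) ^ (2 * n))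
      fun z _ => ?_).trans (le_of_eq ?_)
    · split_ifs with hz
      · exact tsum_two_coincidences_le g y hC hA hfin _ _ _ _ hz
      · simp
    · simp only [Finset.card_univ, Fintype.card_prod, Fintype.card_fin, nsmul_eq_mul]
      push_cast
      ring

end Combinatorics

/-! ### Integrating out all entries of a symmetric kernel but one. -/

lemma insertNth_eq_cons_of_symmetric {β : Type*} {n : ℕ} {g : (Fin (n + 1) → β) → ℝ≥0∞}
    (hg : ∀ (s : Equiv.Perm (Fin (n + 1))) x, g (x ∘ s) = g x) (q : Fin (n + 1)) (z : β)
    (w : Fin n → β) : g (q.insertNth z w) = g (Fin.cons z w) := by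
  rw [← Fin.cons_comp_cycleRange, hg]

section Integrals

variable {β : Type*} [MeasurableSpace β] {μ : Measure β} [SigmaFinite μ]

lemma measurable_insertNth {n : ℕ} (q : Fin (n + 1)) :
    Measurable fun x : β × (Fin n → β) => (q.insertNth x.1 x.2 : Fin (n + 1) → β) :=
  (MeasurableEquiv.piFinSuccAbove (fun _ => β) q).symm.measurable

lemma measurable_finCons {n : ℕ} :
    Measurable fun x : β × (Fin n → β) => (Fin.cons x.1 x.2 : Fin (n + 1) → β) := by
  refine measurable_pi_lambda _ fun j => ?_
  refine Fin.cases ?_ (fun i => ?_) j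
  · simpa using measurable_fst
  · simp only [Fin.cons_succ]
    exact (measurable_pi_apply i).comp measurable_snd

lemma lintegral_pi_insertNth {n : ℕ} (q : Fin (n + 1)) {G : (Fin (n + 1) → β) → ℝ≥0∞}
    (hG : Measurable G) :
    ∫⁻ x, G x ∂(Measure.pi fun _ => μ) =
      ∫⁻ z, ∫⁻ w, G (q.insertNth z w) ∂(Measure.pi fun _ : Fin n => μ) ∂μ := by
  have h := (measurePreserving_piFinSuccAbove (fun _ : Fin (n + 1) => μ) q).symm
  rw [← h.lintegral_comp_emb (MeasurableEquiv.measurableEmbedding _), lintegral_prod]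
  · rfl
  · exact (hG.comp (measurable_insertNth q)).aemeasurable

lemma lintegral_pi_sum {ι ι' : Type*} [Fintype ι] [Fintype ι'] {G : (ι ⊕ ι' → β) → ℝ≥0∞}
    (hG : Measurable G) :
    ∫⁻ x, G x ∂(Measure.pi fun _ => μ) =
      ∫⁻ z, ∫⁻ w, G (Sum.elim z w) ∂(Measure.pi fun _ : ι' => μ) ∂(Measure.pi fun _ : ι => μ) := by
  have h := measurePreserving_sumPiEquivProdPi_symm (fun _ : ι ⊕ ι' => μ)
  have e : ∀ x : (ι → β) × (ι' → β),
      (MeasurableEquiv.sumPiEquivProdPi fun _ : ι ⊕ ι' => β).symm x = Sum.elim x.1 x.2 := by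
    intro x
    funext j
    cases j <;> rfl
  rw [← h.lintegral_comp_emb (MeasurableEquiv.measurableEmbedding _), lintegral_prod]
  · simp_rw [e]
  · exact (hG.comp (MeasurableEquiv.measurable _)).aemeasurable

end Integrals

/-- The first-order kernel `z ↦ ∫ g (z, w) μ^n(dw)` of `g`. -/
noncomputable def firstKernel {β : Type*} [MeasurableSpace β] (μ : Measure β) {n : ℕ}
    (g : (Fin (n + 1) → β) → ℝ≥0∞) (z : β) : ℝ≥0∞ :=
  ∫⁻ w, g (Fin.cons z w) ∂(Measure.pi fun _ : Fin n => μ)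

section FirstKernel

variable {β : Type*} [MeasurableSpace β] {μ : Measure β} [SigmaFinite μ] {n : ℕ}
  {g : (Fin (n + 1) → β) → ℝ≥0∞}

lemma measurable_firstKernel (hg : Measurable g) : Measurable (firstKernel μ g) :=
  (hg.comp measurable_finCons).lintegral_prod_right'

lemma lintegral_firstKernel (hg : Measurable g)
    (hs : ∀ (s : Equiv.Perm (Fin (n + 1))) x, g (x ∘ s) = g x) :
    ∫⁻ z, firstKernel μ g z ∂μ = ∫⁻ x, g x ∂(Measure.pi fun _ => μ) := by
  rw [lintegral_pi_insertNth 0 hg]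
  simp_rw [insertNth_eq_cons_of_symmetric hs]
  rfl

lemma lintegral_mul_firstKernel (hg : Measurable g)
    (hs : ∀ (s : Equiv.Perm (Fin (n + 1))) x, g (x ∘ s) = g x) (p : Fin (n + 1)) :
    ∫⁻ x, g x * firstKernel μ g (x p) ∂(Measure.pi fun _ => μ) =
      ∫⁻ z, firstKernel μ g z ^ 2 ∂μ := by
  have hm := measurable_firstKernel (μ := μ) hg
  have hm' : Measurable fun x : Fin (n + 1) → β => g x * firstKernel μ g (x p) := by fun_prop
  rw [lintegral_pi_insertNth p hm']
  refine lintegral_congr fun z => ?_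
  simp only [Fin.insertNth_apply_same, insertNth_eq_cons_of_symmetric hs]
  rw [lintegral_mul_const, sq]
  · rfl
  · exact hg.comp (measurable_finCons.comp measurable_prodMk_left)

lemma measurable_mul_insertNth (hg : Measurable g) (p q : Fin (n + 1)) :
    Measurable fun x : Fin (n + 1) ⊕ Fin n → β =>
      g (fun j => x (.inl j)) * g (q.insertNth (x (.inl p)) fun j => x (.inr j)) := by
  have h : Measurable fun x : Fin (n + 1) ⊕ Fin n → β =>
      (q.insertNth (x (.inl p)) (fun j => x (.inr j)) : Fin (n + 1) → β) :=
    (measurable_insertNth q).comp (f := fun x : Fin (n + 1) ⊕ Fin n → β =>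
      (x (.inl p), fun j => x (.inr j))) (by fun_prop)
  exact (hg.comp (by fun_prop)).mul (hg.comp h)

/-- Given the shared entry, the remaining entries of the two tuples are integrated independently,
each side giving one factor `firstKernel μ g z`. Symmetry makes the positions `p` and `q`
irrelevant. -/
lemma lintegral_insertNth_pair (hg : Measurable g)
    (hs : ∀ (s : Equiv.Perm (Fin (n + 1))) x, g (x ∘ s) = g x) (p q : Fin (n + 1)) :
    ∫⁻ x, g (fun j => x (.inl j)) * g (q.insertNth (x (.inl p)) fun j => x (.inr j))
      ∂(Measure.pi fun _ : Fin (n + 1) ⊕ Fin n => μ) = ∫⁻ z, firstKernel μ g z ^ 2 ∂μ := by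
  rw [lintegral_pi_sum (measurable_mul_insertNth hg p q), ← lintegral_mul_firstKernel hg hs p]
  refine lintegral_congr fun z => ?_
  simp only [Sum.elim_inl, Sum.elim_inr, insertNth_eq_cons_of_symmetric hs]
  rw [lintegral_const_mul]
  · rfl
  · exact hg.comp (measurable_finCons.comp measurable_prodMk_left)

end FirstKernel

/-! ### First and second moments of U-statistics. -/

/-- If `N ≥ 2j`, every factor of the falling factorial is at least `N / 2`; otherwise `N` is bounded
by `2j`. This turns factorial moments into bounds for ordinary ones. -/
lemma pow_le_two_pow_mul_descFactorial (N j : ℕ) :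
    N ^ j ≤ 2 ^ j * N.descFactorial j + (2 * j) ^ j := by
  rcases le_or_gt (2 * j) N with h | h
  · refine le_add_right ?_
    calc N ^ j ≤ (2 * (N + 1 - j)) ^ j := Nat.pow_le_pow_left (by omega) j
      _ = 2 ^ j * (N + 1 - j) ^ j := mul_pow _ _ _
      _ ≤ _ := Nat.mul_le_mul_left _ (Nat.pow_sub_le_descFactorial N j)
  · exact le_add_left (Nat.pow_le_pow_left h.le j)

namespace IsPoissonProcess

variable {Ω β : Type*} [MeasurableSpace Ω] [MeasurableSpace β] {P : Measure Ω}
  {μ : Measure β} {Y : ℕ → Ω → β}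

lemma isProbabilityMeasure (h : IsPoissonProcess P μ Y) : IsProbabilityMeasure P :=
  (h.count_indep 0 (fun _ => ∅) (fun _ => .empty) (fun i => i.elim0)).isProbabilityMeasure

lemma lintegral_encard_pow_le (h : IsPoissonProcess P μ Y) {A : Set β} (hA : MeasurableSet A)
    (hfin : μ A ≠ ∞) (h1 : 1 ≤ μ A) (j : ℕ) :
    ∫⁻ ω, ((Set.encard {i : ℕ | Y i ω ∈ A}).toNat : ℝ≥0∞) ^ j ∂P ≤
      (2 ^ j + (2 * j) ^ j) * μ A ^ j := by
  have hP := h.isProbabilityMeasure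
  have hm : Measurable fun ω =>
      ((Set.encard {i : ℕ | Y i ω ∈ A}).toNat.descFactorial j : ℝ≥0∞) :=
    (Measurable.of_discrete (f := fun x : ℕ∞ => (x.toNat.descFactorial j : ℝ≥0∞))).comp
      (measurable_encard_setOf_mem h.measurable hA)
  calc ∫⁻ ω, ((Set.encard {i : ℕ | Y i ω ∈ A}).toNat : ℝ≥0∞) ^ j ∂P
      ≤ ∫⁻ ω, (2 ^ j * ((Set.encard {i : ℕ | Y i ω ∈ A}).toNat.descFactorial j : ℝ≥0∞) +
          (2 * j) ^ j) ∂P := by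
        refine lintegral_mono fun ω => ?_
        have := (Nat.cast_le (α := ℝ≥0∞)).2 (pow_le_two_pow_mul_descFactorial
          (Set.encard {i : ℕ | Y i ω ∈ A}).toNat j)
        push_cast at this
        exact this
    _ = 2 ^ j * μ A ^ j + (2 * j) ^ j := by
        rw [lintegral_add_right _ measurable_const, lintegral_const_mul _ hm,
          h.lintegral_descFactorial hA hfin, lintegral_const, measure_univ, mul_one]
    _ ≤ (2 ^ j + (2 * j) ^ j) * μ A ^ j := by
        rw [add_mul]
        gcongr
        exact le_mul_of_one_le_right' (one_le_pow₀ h1)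

variable [SigmaFinite μ]

lemma lintegral_tsum_nat (h : IsPoissonProcess P μ Y) {f : β → ℝ≥0∞} (hf : Measurable f) :
    ∫⁻ ω, ∑' i, f (Y i ω) ∂P = ∫⁻ z, f z ∂μ := by
  have hf0 : Measurable fun x : Fin 1 → β => f (x 0) := hf.comp (measurable_pi_apply 0)
  have h1 := h.lintegral_tsum_embedding (ι := Fin 1) hf0
  have h2 : ∀ ω, ∑' a : Fin 1 ↪ ℕ, f (Y (a 0) ω) = ∑' i, f (Y i ω) := fun ω =>
    (Equiv.uniqueEmbeddingEquivResult (α := Fin 1) (β := ℕ)).tsum_eq fun i => f (Y i ω)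
  simp_rw [h2] at h1
  rw [h1, lintegral_pi_insertNth 0 hf0]
  simp

lemma lintegral_tsum_embedding_mul (h : IsPoissonProcess P μ Y) {k : ℕ}
    {g : (Fin k → β) → ℝ≥0∞} (hg : Measurable g) {f : β → ℝ≥0∞} (hf : Measurable f) :
    ∫⁻ ω, (∑' a : Fin k ↪ ℕ, g fun j => Y (a j) ω) * ∑' i, f (Y i ω) ∂P =
      (∫⁻ x, g x ∂(Measure.pi fun _ => μ)) * ∫⁻ z, f z ∂μ +
        ∑ p, ∫⁻ x, g x * f (x p) ∂(Measure.pi fun _ => μ) := by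
  have hm1 : Measurable fun x : Fin (k + 1) → β => g (fun j => x j.succ) * f (x 0) :=
    (hg.comp (by fun_prop)).mul (hf.comp (measurable_pi_apply 0))
  have hm2 : ∀ p : Fin k, Measurable fun x : Fin k → β => g x * f (x p) := fun p =>
    hg.mul (hf.comp (measurable_pi_apply p))
  have hY : ∀ {ι : Type} [Fintype ι] (a : ι ↪ ℕ), Measurable fun ω j => Y (a j) ω :=
    fun a => measurable_pi_lambda _ fun j => h.measurable _
  have hs1 : Measurable fun ω => ∑' b : Fin (k + 1) ↪ ℕ,
      g (fun j => Y (b j.succ) ω) * f (Y (b 0) ω) :=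
    Measurable.tsum fun b => hm1.comp (hY b)
  have hs2 : ∀ p : Fin k, Measurable fun ω => ∑' a : Fin k ↪ ℕ,
      g (fun j => Y (a j) ω) * f (Y (a p) ω) := fun p =>
    Measurable.tsum fun b => (hm2 p).comp (hY b)
  rw [lintegral_congr fun ω => tsum_embedding_mul_tsum g f fun i => Y i ω,
    lintegral_add_left hs1, lintegral_finsetSum _ (fun p _ => hs2 p)]
  congr 1
  · rw [h.lintegral_tsum_embedding hm1, lintegral_pi_insertNth 0 hm1]
    simp only [Fin.insertNth_zero', Fin.cons_succ, Fin.cons_zero]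
    simp_rw [lintegral_mul_const _ hg]
    rw [lintegral_const_mul _ hf]
  · exact Finset.sum_congr rfl fun p _ => h.lintegral_tsum_embedding (hm2 p)

lemma lintegral_tsum_nat_sq (h : IsPoissonProcess P μ Y) {f : β → ℝ≥0∞} (hf : Measurable f) :
    ∫⁻ ω, (∑' i, f (Y i ω)) ^ 2 ∂P = (∫⁻ z, f z ∂μ) ^ 2 + ∫⁻ z, f z ^ 2 ∂μ := by
  have hf0 : Measurable fun x : Fin 1 → β => f (x 0) := hf.comp (measurable_pi_apply 0)
  have h1 := h.lintegral_tsum_embedding_mul (k := 1) hf0 hf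
  have h2 : ∀ ω, ∑' a : Fin 1 ↪ ℕ, f (Y (a 0) ω) = ∑' i, f (Y i ω) := fun ω =>
    (Equiv.uniqueEmbeddingEquivResult (α := Fin 1) (β := ℕ)).tsum_eq fun i => f (Y i ω)
  simp_rw [h2] at h1
  rw [lintegral_pi_insertNth 0 hf0] at h1
  simp only [Fin.sum_univ_one] at h1
  have hf1 : Measurable fun x : Fin 1 → β => f (x 0) * f (x 0) := hf0.mul hf0
  rw [lintegral_pi_insertNth 0 hf1] at h1
  simp_rw [sq]
  rw [h1]
  simp

/-- The expectation of `tsum_embedding_sq_le`. When the intensity is `t` times a fixed measure, the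
middle term has order `t ^ (2n + 1)` and the last only `t ^ (2n)`. -/
lemma lintegral_tsum_embedding_sq_le (h : IsPoissonProcess P μ Y) {n : ℕ}
    {g : (Fin (n + 1) → β) → ℝ≥0∞} (hg : Measurable g)
    (hs : ∀ (s : Equiv.Perm (Fin (n + 1))) x, g (x ∘ s) = g x)
    {C : ℝ≥0∞} (hC : ∀ x, g x ≤ C) {A : Set β} (hAm : MeasurableSet A)
    (hA : ∀ x, (∃ j, x j ∉ A) → g x = 0) (hfin : μ A ≠ ∞) (h1 : 1 ≤ μ A) :
    ∫⁻ ω, (∑' a : Fin (n + 1) ↪ ℕ, g fun j => Y (a j) ω) ^ 2 ∂P ≤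
      (∫⁻ x, g x ∂(Measure.pi fun _ => μ)) ^ 2 +
        (n + 1) ^ 2 * ∫⁻ z, firstKernel μ g z ^ 2 ∂μ +
        (n + 1) ^ 4 * C ^ 2 * (2 ^ (2 * n) + (2 * (2 * n : ℕ)) ^ (2 * n)) * μ A ^ (2 * n) := by
  have hm1 : Measurable fun x : Fin (n + 1) ⊕ Fin (n + 1) → β =>
      g (fun j => x (.inl j)) * g (fun j => x (.inr j)) :=
    (hg.comp (by fun_prop)).mul (hg.comp (by fun_prop))
  have hm2 : ∀ p q : Fin (n + 1), Measurable fun x : Fin (n + 1) ⊕ Fin n → β =>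
      g (fun j => x (.inl j)) * g (q.insertNth (x (.inl p)) fun j => x (.inr j)) :=
    fun p q => measurable_mul_insertNth hg p q
  have hY : ∀ {ι : Type} [Fintype ι] (a : ι ↪ ℕ), Measurable fun ω j => Y (a j) ω :=
    fun a => measurable_pi_lambda _ fun j => h.measurable _
  have hs1 : Measurable fun ω => ∑' c : Fin (n + 1) ⊕ Fin (n + 1) ↪ ℕ,
      g (fun j => Y (c (.inl j)) ω) * g (fun j => Y (c (.inr j)) ω) :=
    Measurable.tsum fun b => hm1.comp (hY b)
  have hs2 : ∀ p q : Fin (n + 1), Measurable fun ω => ∑' c : Fin (n + 1) ⊕ Fin n ↪ ℕ,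
      g (fun j => Y (c (.inl j)) ω) *
        g (q.insertNth (Y (c (.inl p)) ω) fun j => Y (c (.inr j)) ω) := fun p q =>
    Measurable.tsum fun b => (hm2 p q).comp (hY b)
  have hs3 : ∀ p : Fin (n + 1), Measurable fun ω => ∑ q : Fin (n + 1),
      ∑' c : Fin (n + 1) ⊕ Fin n ↪ ℕ, g (fun j => Y (c (.inl j)) ω) *
        g (q.insertNth (Y (c (.inl p)) ω) fun j => Y (c (.inr j)) ω) := fun p =>
    Finset.measurable_fun_sum _ fun q _ => hs2 p q
  refine (lintegral_mono_ae ((h.ae_finite hAm hfin).mono fun ω hω =>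
    tsum_embedding_sq_le g (fun i => Y i ω) hC hA hω)).trans ?_
  have hmN : Measurable fun ω => ((Set.encard {i : ℕ | Y i ω ∈ A}).toNat : ℝ≥0∞) ^ (2 * n) :=
    (Measurable.of_discrete (f := fun x : ℕ∞ => (x.toNat : ℝ≥0∞) ^ (2 * n))).comp
      (measurable_encard_setOf_mem h.measurable hAm)
  rw [lintegral_add_right _ ((hmN.const_mul _).const_mul _), lintegral_add_left hs1, lintegral_finsetSum _ fun p _ => hs3 p]
  refine add_le_add (add_le_add (le_of_eq ?_) (le_of_eq ?_)) ?_
  · rw [h.lintegral_tsum_embedding hm1, lintegral_pi_sum hm1, sq]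
    simp only [Sum.elim_inl, Sum.elim_inr]
    simp_rw [lintegral_const_mul _ hg]
    rw [lintegral_mul_const _ hg]
  · have : ∀ p q : Fin (n + 1), ∫⁻ ω, ∑' c : Fin (n + 1) ⊕ Fin n ↪ ℕ,
        g (fun j => Y (c (.inl j)) ω) *
          g (q.insertNth (Y (c (.inl p)) ω) fun j => Y (c (.inr j)) ω) ∂P =
        ∫⁻ z, firstKernel μ g z ^ 2 ∂μ := fun p q =>
      (h.lintegral_tsum_embedding (hm2 p q)).trans (lintegral_insertNth_pair hg hs p q)
    rw [Finset.sum_congr rfl fun p _ => lintegral_finsetSum _ fun q _ => hs2 p q]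
    simp_rw [this]
    simp only [Finset.sum_const, Finset.card_univ, Fintype.card_fin, nsmul_eq_mul]
    push_cast
    ring
  · rw [lintegral_const_mul _ (hmN.const_mul _), lintegral_const_mul _ hmN]
    rw [mul_assoc, mul_assoc]
    gcongr
    exact h.lintegral_encard_pow_le hAm hfin h1 (2 * n)

end IsPoissonProcess

/-! ### Linear projection and the central limit theorem for U-statistics. -/

/-- A second moment computation: the remainder of `F` after its linear approximation `c * L`. -/
lemma integral_sq_remainder_le {Ω : Type*} [MeasurableSpace Ω] {P : Measure Ω}
    [IsProbabilityMeasure P] {F L : Ω → ℝ≥0∞} (hF : Measurable F) (hL : Measurable L)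
    {M v R c : ℝ≥0} (hFM : ∫⁻ ω, F ω ∂P = M) (hLM : ∫⁻ ω, L ω ∂P = M)
    (hFL : ∫⁻ ω, F ω * L ω ∂P = M * M + c * v) (hLL : ∫⁻ ω, L ω ^ 2 ∂P = M ^ 2 + v)
    (hFF : ∫⁻ ω, F ω ^ 2 ∂P ≤ M ^ 2 + c ^ 2 * v + R) :
    Integrable (fun ω => ((F ω).toReal - (c : ℝ) * (L ω).toReal - (1 - (c : ℝ)) * M) ^ 2) P ∧
      ∫ ω, ((F ω).toReal - (c : ℝ) * (L ω).toReal - (1 - (c : ℝ)) * M) ^ 2 ∂P ≤ (R : ℝ) := by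
  have key : ∀ (G : Ω → ℝ≥0∞) (b : ℝ≥0), Measurable G → ∫⁻ ω, G ω ∂P = b →
      Integrable (fun ω => (G ω).toReal) P ∧ ∫ ω, (G ω).toReal ∂P = (b : ℝ) := by
    intro G b hG hb
    have hne : ∫⁻ ω, G ω ∂P ≠ ∞ := by rw [hb]; exact ENNReal.coe_ne_top
    refine ⟨integrable_toReal_of_lintegral_ne_top hG.aemeasurable hne, ?_⟩
    rw [integral_toReal hG.aemeasurable (ae_lt_top hG hne), hb, ENNReal.coe_toReal]
  have hne : ∫⁻ ω, F ω ^ 2 ∂P ≠ ∞ := by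
    refine (hFF.trans_lt ?_).ne
    have : (M : ℝ≥0∞) ^ 2 + c ^ 2 * v + R = ((M ^ 2 + c ^ 2 * v + R : ℝ≥0) : ℝ≥0∞) := by
      push_cast; rfl
    rw [this]
    exact ENNReal.coe_lt_top
  lift ∫⁻ ω, F ω ^ 2 ∂P to ℝ≥0 using hne with b hb
  obtain ⟨i1, e1⟩ := key F M hF hFM
  obtain ⟨i2, e2⟩ := key L M hL hLM
  obtain ⟨i3, e3⟩ := key (fun ω => F ω * L ω) (M * M + c * v) (hF.mul hL) (by rw [hFL]; push_cast; rfl)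
  obtain ⟨i4, e4⟩ := key (fun ω => L ω ^ 2) (M ^ 2 + v) (hL.pow_const 2) (by rw [hLL]; push_cast; rfl)
  obtain ⟨i5, e5⟩ := key (fun ω => F ω ^ 2) b (hF.pow_const 2) hb.symm
  have hb' : (b : ℝ) ≤ M ^ 2 + c ^ 2 * v + R := by exact_mod_cast hFF
  simp only [ENNReal.toReal_mul, ENNReal.toReal_pow] at i3 e3 i4 e4 i5 e5
  have hexp : ∀ ω, ((F ω).toReal - (c : ℝ) * (L ω).toReal - (1 - (c : ℝ)) * M) ^ 2 =
      (F ω).toReal ^ 2 + (-(2 * (c : ℝ))) * ((F ω).toReal * (L ω).toReal) + (c : ℝ) ^ 2 * (L ω).toReal ^ 2 +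
        (-(2 * (1 - (c : ℝ)) * M)) * (F ω).toReal + (2 * (c : ℝ) * (1 - (c : ℝ)) * M) * (L ω).toReal +
        ((1 - (c : ℝ)) * M) ^ 2 := fun ω => by ring
  simp_rw [hexp]
  have j2 := i5.add (i3.const_mul (-(2 * (c : ℝ))))
  have j3 := j2.add (i4.const_mul ((c : ℝ) ^ 2))
  have j4 := j3.add (i1.const_mul (-(2 * (1 - (c : ℝ)) * M)))
  have j5 := j4.add (i2.const_mul (2 * (c : ℝ) * (1 - (c : ℝ)) * M))
  have j6 := j5.add (integrable_const (μ := P) (((1 - (c : ℝ)) * M) ^ 2))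
  refine ⟨j6, ?_⟩
  have e : ∫ ω, ((F ω).toReal ^ 2 + (-(2 * (c : ℝ))) * ((F ω).toReal * (L ω).toReal) +
      (c : ℝ) ^ 2 * (L ω).toReal ^ 2 + (-(2 * (1 - (c : ℝ)) * M)) * (F ω).toReal +
      (2 * (c : ℝ) * (1 - (c : ℝ)) * M) * (L ω).toReal + ((1 - (c : ℝ)) * M) ^ 2) ∂P =
      (b : ℝ) + (-(2 * (c : ℝ))) * (M * M + c * v) + (c : ℝ) ^ 2 * (M ^ 2 + v) + (-(2 * (1 - (c : ℝ)) * M)) * M +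
        (2 * (c : ℝ) * (1 - (c : ℝ)) * M) * M + ((1 - (c : ℝ)) * M) ^ 2 := by
    refine (integral_add j5 (integrable_const _)).trans ?_
    refine congrArg₂ (· + ·) ?_ (by simp)
    refine (integral_add j4 (i2.const_mul _)).trans ?_
    refine congrArg₂ (· + ·) ?_ (by rw [integral_const_mul, e2])
    refine (integral_add j3 (i1.const_mul _)).trans ?_
    refine congrArg₂ (· + ·) ?_ (by rw [integral_const_mul, e1])
    refine (integral_add j2 (i4.const_mul _)).trans ?_
    refine congrArg₂ (· + ·) ?_ (by rw [integral_const_mul, e4]; push_cast; ring)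
    refine (integral_add i5 (i3.const_mul _)).trans ?_
    exact congrArg₂ (· + ·) e5 (by rw [integral_const_mul, e3]; push_cast; ring)
  -- The terms in `M` and `v` collapse: the second moment equals `b - M² - c² v`.
  rw [e]
  nlinarith [hb']

section Restrict

variable {β : Type*} [MeasurableSpace β]

lemma pi_smul_const {ι : Type*} [Fintype ι] (Q : Measure β) [IsProbabilityMeasure Q] {c : ℝ≥0∞}
    (hc : c ≠ ∞) :
    Measure.pi (fun _ : ι => c • Q) = c ^ Fintype.card ι • Measure.pi fun _ : ι => Q := by
  have : IsFiniteMeasure (c • Q) := Q.smul_finite hc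
  refine Measure.pi_eq fun s _ => ?_
  simp [Measure.smul_apply, Finset.prod_mul_distrib, Finset.prod_const]

lemma lintegral_pi_of_restrict {ι : Type*} [Fintype ι] {μ : Measure β} [SigmaFinite μ]
    {Q : Measure β} [IsProbabilityMeasure Q] {c : ℝ≥0∞} (hc : c ≠ ∞) {A : Set β}
    (hA : MeasurableSet A) (hμ : μ.restrict A = c • Q) {G : (ι → β) → ℝ≥0∞}
    (hG : ∀ x, (∃ j, x j ∉ A) → G x = 0) :
    ∫⁻ x, G x ∂(Measure.pi fun _ => μ) =
      c ^ Fintype.card ι * ∫⁻ x, G x ∂(Measure.pi fun _ => Q) := by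
  have h1 : G = (Set.univ.pi fun _ => A).indicator G := by
    symm
    rw [Set.indicator_eq_self]
    intro x hx
    by_contra h
    simp only [Set.mem_pi, Set.mem_univ, true_implies, not_forall] at h
    exact hx (hG x h)
  rw [h1, lintegral_indicator (MeasurableSet.univ_pi fun _ => hA), ← h1, Measure.restrict_pi_pi,
    hμ, pi_smul_const Q hc, lintegral_smul_measure, smul_eq_mul]

end Restrict

/-- Central limit theorem for Poisson U-statistics with a bounded symmetric kernel and growing
intensity. -/
theorem tendstoInDistribution_tsum_embedding {Ω β κ : Type*} [MeasurableSpace Ω]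
    [MeasurableSpace β] {P : Measure Ω} [IsProbabilityMeasure P] {l : Filter κ}
    [l.IsCountablyGenerated] {Q : Measure β} [IsProbabilityMeasure Q] {μ : κ → Measure β}
    [∀ r, SigmaFinite (μ r)] {Y : κ → ℕ → Ω → β} {t : κ → ℝ}
    (ht : Tendsto t l atTop) (hmeas : ∀ r i, Measurable (Y r i))
    (hY : ∀ᶠ r in l, IsPoissonProcess P (μ r) (Y r)) {A : Set β} (hA : MeasurableSet A)
    (hμ : ∀ᶠ r in l, (μ r).restrict A = ENNReal.ofReal (t r) • Q) {n : ℕ}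
    {g : (Fin (n + 1) → β) → ℝ≥0∞} (hg : Measurable g)
    (hs : ∀ (s : Equiv.Perm (Fin (n + 1))) x, g (x ∘ s) = g x)
    {C : ℝ≥0} (hC : ∀ x, g x ≤ C) (hg0 : ∀ x, (∃ j, x j ∉ A) → g x = 0)
    {v : ℝ≥0} (hv : ∫⁻ z, firstKernel Q g z ^ 2 ∂Q = v) :
    TendstoInDistribution
      (fun r ω => ((∑' a : Fin (n + 1) ↪ ℕ, g fun j => Y r (a j) ω).toReal -
        ∫ ω', (∑' a : Fin (n + 1) ↪ ℕ, g fun j => Y r (a j) ω').toReal ∂P) /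
          ((n + 1) * (√(t r) * t r ^ n))) l id (fun _ => P) (gaussianReal 0 v) := by
  have hh : Measurable (firstKernel Q g) := measurable_firstKernel hg
  have hhC : ∀ z, firstKernel Q g z ≤ C := fun z =>
    (lintegral_mono fun w => hC _).trans (by simp)
  have hh0 : ∀ z ∉ A, firstKernel Q g z = 0 := fun z hz => by
    rw [firstKernel, lintegral_congr fun w => hg0 (Fin.cons z w) ⟨0, by simpa using hz⟩,
      lintegral_zero]
  have hhtop : ∀ z, firstKernel Q g z ≠ ∞ := fun z => ((hhC z).trans_lt ENNReal.coe_lt_top).ne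
  have hCR : ∀ z, |(firstKernel Q g z).toReal| ≤ C := fun z => by
    rw [abs_of_nonneg ENNReal.toReal_nonneg]
    exact ENNReal.toReal_le_coe_of_le_coe (hhC z)
  have hvR : ∫ z, (firstKernel Q g z).toReal ^ 2 ∂Q = v := by
    have h1 := integral_toReal (μ := Q) (f := fun z => firstKernel Q g z ^ 2)
      (hh.pow_const 2).aemeasurable (ae_of_all _ fun z => ENNReal.pow_lt_top (hhtop z).lt_top)
    simp only [ENNReal.toReal_pow] at h1
    rw [h1, hv, ENNReal.coe_toReal]
  have hlin := tendstoInDistribution_tsum ht hmeas hY hA hμ hh.ennreal_toReal hCR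
    (fun x hx => by simp [hh0 x hx]) hvR
  have hFm : ∀ r, Measurable fun ω => ∑' a : Fin (n + 1) ↪ ℕ, g fun j => Y r (a j) ω := fun r =>
    Measurable.tsum fun a => hg.comp (measurable_pi_lambda _ fun j => hmeas _ _)
  -- By Slutsky's theorem it remains to show that the two normalised statistics differ by a term
  -- tending to `0` in probability.
  refine tendstoInDistribution_of_tendstoInMeasure_sub _ _ hlin ?_ fun r =>
    ((hFm r).ennreal_toReal.sub_const _).div_const _ |>.aemeasurable
  set K : ℝ≥0 := (n + 1) ^ 4 * C ^ 2 * (2 ^ (2 * n) + (2 * (2 * n : ℕ)) ^ (2 * n)) with hK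
  -- Chebyshev: a second moment at most `K t^(2n)` against the squared scale `(n+1)² t^(2n+1)`
  -- leaves a factor `1 / t`.
  have hbound : ∀ᶠ r in l, ∀ ε : ℝ, 0 < ε →
      P.real {ω | ε ≤ ‖((∑' a : Fin (n + 1) ↪ ℕ, g fun j => Y r (a j) ω).toReal -
        ∫ ω', (∑' a : Fin (n + 1) ↪ ℕ, g fun j => Y r (a j) ω').toReal ∂P) /
          ((n + 1) * (√(t r) * t r ^ n)) -
        (∑' i, (firstKernel Q g (Y r i ω)).toReal - t r * ∫ x, (firstKernel Q g x).toReal ∂Q) /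
          √(t r)‖} ≤ K / (ε ^ 2 * (n + 1) ^ 2) / t r := by
    filter_upwards [hY, hμ, ht.eventually_ge_atTop 1] with r h1 h2 h3 ε hε
    set τ := t r with hτ
    have hτ0 : 0 < τ := by linarith
    have hμA : μ r A = ENNReal.ofReal τ := by
      have := congrArg (fun m : Measure β => m Set.univ) h2
      simpa using this
    have hμA1 : 1 ≤ μ r A := by rw [hμA]; exact ENNReal.one_le_ofReal.2 h3
    have hμAtop : μ r A ≠ ∞ := by rw [hμA]; exact ENNReal.ofReal_ne_top
    have hfk : ∀ z, firstKernel (μ r) g z = ENNReal.ofReal τ ^ n * firstKernel Q g z := fun z => by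
      rw [firstKernel, lintegral_pi_of_restrict ENNReal.ofReal_ne_top hA h2, Fintype.card_fin]
      · rfl
      · rintro w ⟨j, hj⟩
        exact hg0 _ ⟨j.succ, by simpa using hj⟩
    set F : Ω → ℝ≥0∞ := fun ω => ∑' a : Fin (n + 1) ↪ ℕ, g fun j => Y r (a j) ω with hF
    set L : Ω → ℝ≥0∞ := fun ω => ∑' i, firstKernel (μ r) g (Y r i ω) with hL
    have hfm : Measurable (firstKernel (μ r) g) := measurable_firstKernel hg
    have hLm : Measurable L := Measurable.tsum fun i => hfm.comp (hmeas r i)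
    have hMθ : ∫⁻ x, g x ∂(Measure.pi fun _ => μ r) =
        ENNReal.ofReal τ ^ (n + 1) * ∫⁻ x, g x ∂(Measure.pi fun _ => Q) := by
      rw [lintegral_pi_of_restrict ENNReal.ofReal_ne_top hA h2 hg0, Fintype.card_fin]
    have hθ : ∫⁻ x, g x ∂(Measure.pi fun _ => Q) ≠ ∞ := by
      refine ((lintegral_mono hC).trans_lt ?_).ne
      simp
    have hM : ∫⁻ x, g x ∂(Measure.pi fun _ => μ r) ≠ ∞ := by
      rw [hMθ]; exact ENNReal.mul_ne_top (ENNReal.pow_ne_top ENNReal.ofReal_ne_top) hθ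
    have hv2 : ∫⁻ z, firstKernel (μ r) g z ^ 2 ∂(μ r) ≠ ∞ := by
      rw [← setLIntegral_eq_of_support_subset (s := A), h2, lintegral_smul_measure]
      · simp_rw [hfk, mul_pow]
        rw [lintegral_const_mul _ (hh.pow_const 2), hv]
        exact ENNReal.mul_ne_top ENNReal.ofReal_ne_top (ENNReal.mul_ne_top
          (ENNReal.pow_ne_top (ENNReal.pow_ne_top ENNReal.ofReal_ne_top)) ENNReal.coe_ne_top)
      · intro z hz
        by_contra hzA
        simp [hfk, hh0 z hzA] at hz
    have hEF : ∫⁻ ω, F ω ∂P = ∫⁻ x, g x ∂(Measure.pi fun _ => μ r) :=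
      h1.lintegral_tsum_embedding hg
    have hEL : ∫⁻ ω, L ω ∂P = ∫⁻ x, g x ∂(Measure.pi fun _ => μ r) :=
      (h1.lintegral_tsum_nat hfm).trans (lintegral_firstKernel hg hs)
    have hEFL : ∫⁻ ω, F ω * L ω ∂P = (∫⁻ x, g x ∂(Measure.pi fun _ => μ r)) *
        (∫⁻ x, g x ∂(Measure.pi fun _ => μ r)) + ((n + 1 : ℝ≥0) : ℝ≥0∞) *
          ∫⁻ z, firstKernel (μ r) g z ^ 2 ∂(μ r) := by
      rw [h1.lintegral_tsum_embedding_mul hg hfm, lintegral_firstKernel hg hs]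
      simp_rw [lintegral_mul_firstKernel hg hs]
      simp
    have hELL : ∫⁻ ω, L ω ^ 2 ∂P = (∫⁻ x, g x ∂(Measure.pi fun _ => μ r)) ^ 2 +
        ∫⁻ z, firstKernel (μ r) g z ^ 2 ∂(μ r) := by
      rw [h1.lintegral_tsum_nat_sq hfm, lintegral_firstKernel hg hs]
    have hEFF : ∫⁻ ω, F ω ^ 2 ∂P ≤ (∫⁻ x, g x ∂(Measure.pi fun _ => μ r)) ^ 2 +
        ((n + 1 : ℝ≥0) : ℝ≥0∞) ^ 2 * ∫⁻ z, firstKernel (μ r) g z ^ 2 ∂(μ r) +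
          ((K * τ.toNNReal ^ (2 * n) : ℝ≥0) : ℝ≥0∞) := by
      refine (h1.lintegral_tsum_embedding_sq_le hg hs hC hA hg0 hμAtop hμA1).trans (le_of_eq ?_)
      rw [hμA, ENNReal.ofReal, hK]
      push_cast
      rfl
    lift ∫⁻ x, g x ∂(Measure.pi fun _ => μ r) to ℝ≥0 using hM with M hMM
    lift ∫⁻ z, firstKernel (μ r) g z ^ 2 ∂(μ r) to ℝ≥0 using hv2 with w hw
    obtain ⟨hint, hle⟩ := integral_sq_remainder_le (hFm r) hLm hEF hEL hEFL hELL hEFF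
    have hMθR : (M : ℝ) = τ ^ (n + 1) * ∫ x, (firstKernel Q g x).toReal ∂Q := by
      rw [integral_toReal hh.aemeasurable (ae_of_all _ fun z => (hhtop z).lt_top),
        lintegral_firstKernel hg hs]
      have := congrArg ENNReal.toReal hMθ
      rw [ENNReal.coe_toReal, ENNReal.toReal_mul, ENNReal.toReal_pow,
        ENNReal.toReal_ofReal hτ0.le] at this
      exact this
    have hEFR : ∫ ω, (F ω).toReal ∂P = M := by
      rw [integral_toReal (hFm r).aemeasurable (ae_lt_top (hFm r) (by rw [hEF]; simp)), hEF,
        ENNReal.coe_toReal]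
    have hLR : ∀ ω, (L ω).toReal = τ ^ n * ∑' i, (firstKernel Q g (Y r i ω)).toReal := fun ω => by
      simp only [hL, hfk]
      rw [ENNReal.tsum_mul_left, ENNReal.toReal_mul, ENNReal.toReal_pow,
        ENNReal.toReal_ofReal hτ0.le, ENNReal.tsum_toReal_eq fun i => hhtop _]
    have hsq : 0 < √τ := Real.sqrt_pos.2 hτ0
    have hsq2 : √τ ^ 2 = τ := Real.sq_sqrt hτ0.le
    -- Since `M = t^(n+1) ∫ h dQ` and `L = t^n ∑ h` with `h = firstKernel Q g`, the difference is
    -- exactly the remainder of `integral_sq_remainder_le` with `c = n + 1`.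
    have hD : ∀ ω, ((F ω).toReal - ∫ ω', (F ω').toReal ∂P) / ((n + 1) * (√τ * τ ^ n)) -
        (∑' i, (firstKernel Q g (Y r i ω)).toReal - τ * ∫ x, (firstKernel Q g x).toReal ∂Q) / √τ =
        ((F ω).toReal - ((n + 1 : ℝ≥0) : ℝ) * (L ω).toReal - (1 - ((n + 1 : ℝ≥0) : ℝ)) * M) /
          ((n + 1) * (√τ * τ ^ n)) := fun ω => by
      rw [hEFR, hLR, hMθR]
      push_cast
      have : (n : ℝ) + 1 ≠ 0 := by positivity
      field_simp
      ring
    have hcheb := mul_meas_ge_le_integral_of_nonneg (μ := P)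
      (ae_of_all _ fun ω => sq_nonneg _) hint (ε ^ 2 * ((n + 1) * (√τ * τ ^ n)) ^ 2)
    have hset : {ω | ε ≤ ‖((F ω).toReal - ∫ ω', (F ω').toReal ∂P) / ((n + 1) * (√τ * τ ^ n)) -
        (∑' i, (firstKernel Q g (Y r i ω)).toReal - τ * ∫ x, (firstKernel Q g x).toReal ∂Q) /
          √τ‖} ⊆ {ω | ε ^ 2 * ((n + 1) * (√τ * τ ^ n)) ^ 2 ≤ ((F ω).toReal -
        ((n + 1 : ℝ≥0) : ℝ) * (L ω).toReal - (1 - ((n + 1 : ℝ≥0) : ℝ)) * M) ^ 2} := by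
      intro ω hω
      simp only [Set.mem_ofPred_eq] at hω ⊢
      rw [hD, norm_div, Real.norm_eq_abs, Real.norm_eq_abs, le_div_iff₀
        (by positivity), abs_of_pos (by positivity : (0 : ℝ) < (n + 1) * (√τ * τ ^ n))] at hω
      rw [← mul_pow, ← sq_abs (_ - _)]
      exact pow_le_pow_left₀ (by positivity) hω 2
    refine (measureReal_mono hset).trans ?_
    have hpos : 0 < ε ^ 2 * ((n + 1) * (√τ * τ ^ n)) ^ 2 := by positivity
    have hfin := hcheb.trans hle
    rw [mul_comm, ← le_div_iff₀ hpos] at hfin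
    refine hfin.trans (le_of_eq ?_)
    have hτn : ((K * τ.toNNReal ^ (2 * n) : ℝ≥0) : ℝ) = K * τ ^ (2 * n) := by
      push_cast
      rw [Real.coe_toNNReal τ hτ0.le]
    rw [hτn, mul_pow, mul_pow, hsq2]
    field_simp
    ring
  rw [tendstoInMeasure_iff_measureReal_norm]
  intro ε hε
  refine tendsto_of_tendsto_of_tendsto_of_le_of_le' tendsto_const_nhds
    (ht.const_div_atTop (K / (ε ^ 2 * (n + 1) ^ 2))) (Eventually.of_forall fun r => by positivity)
    (hbound.mono fun r hr => ?_)
  simpa using hr ε hε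

/-! ### Intersections of hyperplanes and degenerate families. -/

section Geometry

variable {d : ℕ} {ι : Type*}

/-- The intersection of the hyperplanes with parameters `x j`. -/
def hyperplaneInter (x : ι → Param d) : Set (E d) := ⋂ j, hyperplane (x j)

lemma mem_hyperplaneInter {x : ι → Param d} {y : E d} :
    y ∈ hyperplaneInter x ↔ ∀ j, inner ℝ y ((x j).2 : E d) = (x j).1 := by
  simp [hyperplaneInter, hyperplane]

lemma hyperplaneInter_comp_equiv {ι' : Type*} (x : ι → Param d) (e : ι' ≃ ι) :
    hyperplaneInter (x ∘ e) = hyperplaneInter x :=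
  e.surjective.iInter_comp fun j => hyperplane (x j)

lemma isClosed_hyperplaneInter (x : ι → Param d) : IsClosed (hyperplaneInter x) := by
  refine isClosed_iInter fun j => ?_
  exact isClosed_eq (by fun_prop) continuous_const

/-- The set is the projection of the closed incidence relation along the compact ball. -/
lemma isClosed_setOf_hits (s : ℝ) :
    IsClosed {x : ι → Param d | hyperplaneInter x ∈ hitsBall d s} := by
  have : CompactSpace (Metric.closedBall (0 : E d) s) :=
    isCompact_iff_compactSpace.1 (isCompact_closedBall 0 s)
  let Z : Set ((ι → Param d) × Metric.closedBall (0 : E d) s) :=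
    {z | ∀ j, inner ℝ (z.2 : E d) ((z.1 j).2 : E d) = (z.1 j).1}
  have hZ : IsClosed Z := by
    have : Z = ⋂ j, {z | inner ℝ (z.2 : E d) ((z.1 j).2 : E d) = (z.1 j).1} := by
      ext z; simp [Z]
    rw [this]
    refine isClosed_iInter fun j => isClosed_eq ?_ ?_
    · exact Continuous.inner (continuous_subtype_val.comp continuous_snd)
        (continuous_subtype_val.comp (continuous_snd.comp
          ((continuous_apply j).comp continuous_fst)))
    · exact continuous_fst.comp ((continuous_apply j).comp continuous_fst)
  have himg : {x : ι → Param d | hyperplaneInter x ∈ hitsBall d s} = Prod.fst '' Z := by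
    ext x
    constructor
    · rintro ⟨y, hy, hyB⟩
      exact ⟨(x, ⟨y, hyB⟩), mem_hyperplaneInter.1 hy, rfl⟩
    · rintro ⟨⟨x', y⟩, hz, rfl⟩
      exact ⟨y, mem_hyperplaneInter.2 hz, y.2⟩
  rw [himg]
  exact isClosedMap_fst_of_compactSpace _ hZ

/-- Hyperplanes with linearly dependent normals that have a common point. -/
def DegenerateFamily (x : ι → Param d) : Prop :=
  ¬ LinearIndependent ℝ (fun j => ((x j).2 : E d)) ∧ (hyperplaneInter x).Nonempty

lemma nonempty_hyperplaneInter_iff {x : ι → Param d} :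
    (hyperplaneInter x).Nonempty ↔ ∃ N : ℕ, hyperplaneInter x ∈ hitsBall d N := by
  constructor
  · rintro ⟨y, hy⟩
    obtain ⟨N, hN⟩ := exists_nat_ge ‖y‖
    exact ⟨N, y, hy, by simpa using hN⟩
  · rintro ⟨N, y, hy, _⟩
    exact ⟨y, hy⟩

/-- Linear independence is an open condition, and having a common point is a countable union of
closed hitting conditions. -/
lemma measurableSet_degenerateFamily [Finite ι] :
    MeasurableSet {x : ι → Param d | DegenerateFamily x} := by
  have h1 : IsOpen {x : ι → Param d | LinearIndependent ℝ (fun j => ((x j).2 : E d))} := by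
    have hc : Continuous fun x : ι → Param d => fun j => ((x j).2 : E d) := by fun_prop
    exact (isOpen_setOfPred_linearIndependent (𝕜 := ℝ) (E := E d) (ι := ι)).preimage hc
  have h2 : {x : ι → Param d | DegenerateFamily x} =
      {x : ι → Param d | LinearIndependent ℝ (fun j => ((x j).2 : E d))}ᶜ ∩
        ⋃ N : ℕ, {x | hyperplaneInter x ∈ hitsBall d N} := by
    ext x
    simp only [DegenerateFamily, nonempty_hyperplaneInter_iff, Set.mem_inter_iff,
      Set.mem_compl_iff, Set.mem_iUnion, Set.mem_ofPred_eq]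
  rw [h2]
  exact h1.measurableSet.compl.inter
    (MeasurableSet.iUnion fun N => (isClosed_setOf_hits _).measurableSet)

/-- The linear map `y ↦ (⟨y, v j⟩)_j`. -/
noncomputable def innerMap (v : ι → E d) : E d →ₗ[ℝ] (ι → ℝ) :=
  LinearMap.pi fun j => (innerₗ (E d)).flip (v j)

@[simp] lemma innerMap_apply (v : ι → E d) (y : E d) (j : ι) :
    innerMap v y j = inner ℝ y (v j) := rfl

/-- The coefficient vector `c` of a linear relation is not attained: pairing a preimage with `∑ c j
• v j = 0` would give `∑ c j ^ 2 = 0`. -/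
lemma range_innerMap_ne_top [Fintype ι] {v : ι → E d} (hv : ¬ LinearIndependent ℝ v) :
    LinearMap.range (innerMap v) ≠ ⊤ := by
  obtain ⟨c, hc, i, hi⟩ := Fintype.not_linearIndependent_iff.1 hv
  intro htop
  obtain ⟨y, hy⟩ : c ∈ LinearMap.range (innerMap v) := by rw [htop]; trivial
  have h0 : inner ℝ y (∑ j, c j • v j) = 0 := by rw [hc, inner_zero_right]
  rw [inner_sum] at h0
  have h1 : ∀ j, inner ℝ y (c j • v j) = c j ^ 2 := fun j => by
    rw [inner_smul_right, sq, ← innerMap_apply, hy]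
  simp_rw [h1] at h0
  exact hi (pow_eq_zero_iff (two_ne_zero) |>.1
    ((Finset.sum_eq_zero_iff_of_nonneg fun j _ => sq_nonneg (c j)).1 h0 i (Finset.mem_univ i)))

lemma ker_innerMap (v : ι → E d) :
    LinearMap.ker (innerMap v) = (Submodule.span ℝ (Set.range v))ᗮ := by
  ext y
  rw [LinearMap.mem_ker, Submodule.mem_orthogonal']
  constructor
  · intro h u hu
    induction hu using Submodule.span_induction with
    | mem u hu => obtain ⟨j, rfl⟩ := hu; exact congrFun h j
    | zero => simp
    | add a b _ _ ha hb => rw [inner_add_right, ha, hb, add_zero]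
    | smul c a _ ha => rw [inner_smul_right, ha, mul_zero]
  · intro h
    funext j
    exact h _ (Submodule.subset_span ⟨j, rfl⟩)

lemma finrank_ker_innerMap [Fintype ι] {v : ι → E d} (hv : LinearIndependent ℝ v) :
    Module.finrank ℝ (LinearMap.ker (innerMap v)) + Fintype.card ι = d := by
  have h := Submodule.finrank_add_finrank_orthogonal (Submodule.span ℝ (Set.range v))
  rw [finrank_span_eq_card hv, finrank_euclideanSpace_fin, ← ker_innerMap] at h
  omega

lemma surjective_innerMap [Fintype ι] {v : ι → E d} (hv : LinearIndependent ℝ v) :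
    Function.Surjective (innerMap v) := by
  rw [← LinearMap.range_eq_top]
  refine Submodule.eq_top_of_finrank_eq ?_
  have h1 := LinearMap.finrank_range_add_finrank_ker (innerMap v)
  have h2 := finrank_ker_innerMap hv
  rw [finrank_euclideanSpace_fin] at h1
  rw [Module.finrank_fintype_fun_eq_card]
  omega

lemma hyperplaneInter_mem_flats [Fintype ι] {x : ι → Param d}
    (hx : LinearIndependent ℝ (fun j => ((x j).2 : E d))) {k : ℕ} (hk : k + Fintype.card ι = d) :
    hyperplaneInter x ∈ flats d k := by
  obtain ⟨y, hy⟩ := surjective_innerMap hx fun j => (x j).1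
  refine ⟨AffineSubspace.mk' y (LinearMap.ker (innerMap fun j => ((x j).2 : E d))),
    ⟨y, AffineSubspace.self_mem_mk' _ _⟩, ?_, ?_⟩
  · rw [AffineSubspace.direction_mk']
    have := finrank_ker_innerMap hx
    omega
  · ext z
    rw [SetLike.mem_coe, AffineSubspace.mem_mk', LinearMap.mem_ker, vsub_eq_sub, map_sub, hy,
      sub_eq_zero, mem_hyperplaneInter]
    exact ⟨fun h j => congrFun h j, fun h => funext h⟩

lemma flats_dim_unique {k k' : ℕ} {L : Set (E d)} (h : L ∈ flats d k) (h' : L ∈ flats d k') :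
    k = k' := by
  obtain ⟨A, _, hA, rfl⟩ := h
  obtain ⟨A', _, hA', h⟩ := h'
  rw [SetLike.coe_set_eq] at h
  subst h
  exact hA.symm.trans hA'

lemma flats_nonempty {k : ℕ} {L : Set (E d)} (h : L ∈ flats d k) : L.Nonempty := by
  obtain ⟨A, hA, _, rfl⟩ := h
  exact hA

instance sigmaFinite_intensityMeasure (lam : ℝ) (Θ : Measure (UpperHemisphere d))
    [IsProbabilityMeasure Θ] : SigmaFinite (intensityMeasure lam Θ) := by
  have : SigmaFinite (ENNReal.ofReal lam • (volume : Measure ℝ)) :=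
    inferInstanceAs (SigmaFinite (lam.toNNReal • (volume : Measure ℝ)))
  unfold intensityMeasure
  infer_instance

/-- Almost no family of hyperplanes is degenerate. -/
lemma pi_intensityMeasure_degenerateFamily [Fintype ι] {lam : ℝ} (hlam : 0 < lam)
    (Θ : Measure (UpperHemisphere d)) [IsProbabilityMeasure Θ] :
    (Measure.pi fun _ : ι => intensityMeasure lam Θ) {x | DegenerateFamily x} = 0 := by
  have hs : SigmaFinite (ENNReal.ofReal lam • (volume : Measure ℝ)) :=
    inferInstanceAs (SigmaFinite (lam.toNNReal • (volume : Measure ℝ)))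
  have hH : (ENNReal.ofReal lam • (volume : Measure ℝ)).IsAddHaarMeasure :=
    Measure.IsAddHaarMeasure.smul _ (by simpa using hlam) ENNReal.ofReal_ne_top
  have hmp := (measurePreserving_arrowProdEquivProdArrow ℝ (UpperHemisphere d) ι
    (fun _ => ENNReal.ofReal lam • (volume : Measure ℝ)) (fun _ => Θ)).symm
  have hm := measurableSet_degenerateFamily (d := d) (ι := ι)
  have : (Measure.pi fun _ : ι => intensityMeasure lam Θ) = Measure.pi fun _ : ι =>
    (ENNReal.ofReal lam • (volume : Measure ℝ)).prod Θ := rfl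
  rw [this, ← hmp.measure_preimage hm.nullMeasurableSet,
    Measure.prod_apply_symm ((MeasurableEquiv.measurable _) hm)]
  refine (lintegral_congr fun v => ?_).trans lintegral_zero
  by_cases hv : LinearIndependent ℝ (fun j => (v j : E d))
  · convert measure_empty (μ := Measure.pi fun _ : ι => ENNReal.ofReal lam • (volume : Measure ℝ))
    ext p
    simp only [Set.mem_preimage, Set.mem_ofPred_eq, Set.mem_empty_iff_false, iff_false]
    exact fun h => h.1 hv
  -- For fixed dependent normals, the offsets admitting a common point form the range of `innerMap`,
  -- a proper subspace and hence a null set.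
  · refine measure_mono_null ?_ (Measure.addHaar_submodule
      (Measure.pi fun _ : ι => ENNReal.ofReal lam • (volume : Measure ℝ)) _
      (range_innerMap_ne_top hv))
    rintro p ⟨-, y, hy⟩
    exact ⟨y, funext fun j => mem_hyperplaneInter.1 hy j⟩

end Geometry

/-! ### Volume of a flat in a ball, as a function of its distance from the centre. -/

section BallVolume

variable {d : ℕ} {ι : Type*}

/-- The `k`-volume of the part in the ball of radius `r` of a `k`-flat at distance `e` from the
centre. -/
noncomputable def flatBallVolume (k : ℕ) (r : ℝ) (e : ℝ≥0∞) : ℝ≥0∞ :=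
  if e ≤ ENNReal.ofReal r then
    volume (Metric.closedBall (0 : EuclideanSpace ℝ (Fin k)) √(r ^ 2 - e.toReal ^ 2)) else 0

lemma antitone_flatBallVolume (k : ℕ) (r : ℝ) : Antitone (flatBallVolume k r) := by
  intro a b hab
  unfold flatBallVolume
  split_ifs with h1 h2 h2
  · refine measure_mono (Metric.closedBall_subset_closedBall (Real.sqrt_le_sqrt ?_))
    have : a.toReal ≤ b.toReal :=
      ENNReal.toReal_mono (h1.trans_lt ENNReal.ofReal_lt_top).ne hab
    have h0 : 0 ≤ a.toReal := ENNReal.toReal_nonneg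
    nlinarith
  · exact absurd (hab.trans h1) h2
  · exact zero_le
  · exact le_rfl

lemma flatBallVolume_le (k : ℕ) (r : ℝ) (e : ℝ≥0∞) :
    flatBallVolume k r e ≤ volume (Metric.closedBall (0 : EuclideanSpace ℝ (Fin k)) |r|) := by
  unfold flatBallVolume
  split_ifs
  · refine measure_mono (Metric.closedBall_subset_closedBall ?_)
    refine Real.sqrt_le_iff.2 ⟨abs_nonneg _, ?_⟩
    rw [sq_abs]
    nlinarith [sq_nonneg e.toReal]
  · exact zero_le

lemma infEDist_le_iff_hits {L : Set (E d)} (hL : IsClosed L) {r : ℝ} (hr : 0 ≤ r) :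
    Metric.infEDist 0 L ≤ ENNReal.ofReal r ↔ L ∈ hitsBall d r := by
  rcases L.eq_empty_or_nonempty with rfl | hne
  · simp [hitsBall]
  constructor
  · intro h
    obtain ⟨y, hy, hyd⟩ := hL.exists_infDist_eq_dist hne 0
    refine ⟨y, hy, ?_⟩
    rw [Metric.mem_closedBall, dist_comm, ← hyd, Metric.infDist]
    exact ENNReal.toReal_le_of_le_ofReal hr h
  · rintro ⟨y, hy, hyB⟩
    refine (Metric.infEDist_le_edist_of_mem hy).trans ?_
    rw [edist_comm, edist_dist]
    exact ENNReal.ofReal_le_ofReal hyB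

/-- By Pythagoras, the section is an isometric copy of a `k`-ball of radius `√(r² - e²)` centred at
the foot of the perpendicular from the origin. -/
lemma euclideanHausdorffMeasure_inter_closedBall {k : ℕ} {L : Set (E d)} (hL : L ∈ flats d k)
    {r : ℝ} (hr : 0 ≤ r) :
    μHE[k] (L ∩ Metric.closedBall 0 r) = flatBallVolume k r (Metric.infEDist 0 L) := by
  obtain ⟨A, ⟨a, ha⟩, hdim, rfl⟩ := hL
  set V := A.direction with hV
  -- The point of `A` nearest to the origin.
  set y := a - V.starProjection a with hy
  have hyV : y ∈ Vᗮ := V.sub_starProjection_mem_orthogonal a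
  have hyA : y ∈ A := by
    have h := AffineSubspace.vadd_mem_of_mem_direction
      (V.neg_mem (V.starProjection_apply_mem a)) ha
    rw [vadd_eq_add, neg_add_eq_sub] at h
    exact h
  have hnorm : ∀ w ∈ V, ‖y + w‖ ^ 2 = ‖y‖ ^ 2 + ‖w‖ ^ 2 := fun w hw => by
    have : inner ℝ y w = 0 := Submodule.inner_left_of_mem_orthogonal hw hyV
    rw [sq, sq, sq]
    exact norm_add_sq_eq_norm_sq_add_norm_sq_of_inner_eq_zero _ _ this
  have hmem : ∀ z, z ∈ A ↔ z - y ∈ V := fun z => by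
    rw [hV, ← vsub_eq_sub, AffineSubspace.vsub_right_mem_direction_iff_mem hyA]
  have hdist : Metric.infEDist 0 (A : Set (E d)) = ENNReal.ofReal ‖y‖ := by
    refine le_antisymm ?_ ?_
    · refine (Metric.infEDist_le_edist_of_mem hyA).trans ?_
      rw [edist_dist, dist_zero_left]
    · refine Metric.le_infEDist.2 fun z hz => ?_
      rw [edist_dist, dist_zero_left]
      refine ENNReal.ofReal_le_ofReal ?_
      have := hnorm _ ((hmem z).1 hz)
      rw [add_sub_cancel] at this
      refine le_of_sq_le_sq ?_ (norm_nonneg _)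
      nlinarith [sq_nonneg ‖z - y‖]
  rw [hdist, flatBallVolume, ENNReal.toReal_ofReal (norm_nonneg _)]
  simp only [ENNReal.ofReal_le_ofReal_iff hr]
  split_ifs with h
  · let b := ((stdOrthonormalBasis ℝ V).reindex (finCongr hdim)).repr.symm
    let f : EuclideanSpace ℝ (Fin k) → E d := fun z => y + (b z : E d)
    have hf : Isometry f := by
      refine Isometry.of_dist_eq fun z z' => ?_
      simp only [f, dist_add_left]
      rw [← Subtype.dist_eq, b.dist_map]
    rw [← EuclideanSpace.euclideanHausdorffMeasure_eq_volume,
      ← hf.euclideanHausdorffMeasure_image]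
    congr 1
    have hball : ∀ w ∈ V, (‖y + w‖ ≤ r ↔ ‖w‖ ≤ √(r ^ 2 - ‖y‖ ^ 2)) := fun w hw => by
      rw [Real.le_sqrt (norm_nonneg _) (by nlinarith [norm_nonneg y]),
        ← pow_le_pow_iff_left₀ (norm_nonneg _) hr two_ne_zero, hnorm w hw]
      constructor <;> intro <;> linarith
    ext z
    simp only [Set.mem_inter_iff, SetLike.mem_coe, Metric.mem_closedBall, dist_zero_right,
      Set.mem_image, f]
    constructor
    · rintro ⟨hzA, hz⟩
      have hzV := (hmem z).1 hzA
      refine ⟨b.symm ⟨z - y, hzV⟩, ?_, ?_⟩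
      · rw [LinearIsometryEquiv.norm_map]
        refine (hball _ hzV).1 ?_
        rw [add_sub_cancel]; exact hz
      · simp
    · rintro ⟨w, hw, rfl⟩
      refine ⟨(hmem _).2 (by rw [add_sub_cancel_left]; exact (b w).2), (hball _ (b w).2).2 ?_⟩
      rw [Submodule.norm_coe, LinearIsometryEquiv.norm_map]
      exact hw
  · refine (congrArg _ ?_).trans (measure_empty (μ := μHE[k]))
    refine Set.eq_empty_of_forall_notMem ?_
    rintro z ⟨hzA, hz⟩
    rw [Metric.mem_closedBall, dist_zero_right] at hz
    apply h
    refine le_trans ?_ hz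
    have := hnorm _ ((hmem z).1 hzA)
    rw [add_sub_cancel] at this
    refine le_of_sq_le_sq ?_ (norm_nonneg _)
    nlinarith [sq_nonneg ‖z - y‖]

/-- The indicator that the hyperplanes have a common point in the ball of radius `r`. -/
noncomputable def hitKernel (r : ℝ) (x : ι → Param d) : ℝ≥0∞ :=
  (hitsBall d r).indicator 1 (hyperplaneInter x)

/-- The `k`-volume in the ball of radius `r` of the intersection of the hyperplanes, in terms of the
distance of the intersection from the origin. -/
noncomputable def volumeKernel (k : ℕ) (r : ℝ) (x : ι → Param d) : ℝ≥0∞ :=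
  flatBallVolume k r (Metric.infEDist 0 (hyperplaneInter x))

lemma measurable_hitKernel [Finite ι] (r : ℝ) :
    Measurable (hitKernel r : (ι → Param d) → ℝ≥0∞) :=
  (measurable_const (a := (1 : ℝ≥0∞))).indicator (isClosed_setOf_hits r).measurableSet

/-- The volume is antitone in the distance from the origin, and the sublevel sets of that distance
are the closed hitting sets. -/
lemma measurable_volumeKernel [Finite ι] (k : ℕ) (r : ℝ) :
    Measurable (volumeKernel k r : (ι → Param d) → ℝ≥0∞) := by
  refine (antitone_flatBallVolume k r).measurable.comp ?_
  refine measurable_of_Iic fun s => ?_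
  rcases eq_or_ne s ∞ with rfl | hs
  · simp
  have : (fun x : ι → Param d => Metric.infEDist 0 (hyperplaneInter x)) ⁻¹' Set.Iic s =
      {x | hyperplaneInter x ∈ hitsBall d s.toReal} := by
    ext x
    rw [Set.mem_preimage, Set.mem_Iic, Set.mem_ofPred_eq,
      ← infEDist_le_iff_hits (isClosed_hyperplaneInter x) ENNReal.toReal_nonneg,
      ENNReal.ofReal_toReal hs]
  rw [this]
  exact (isClosed_setOf_hits _).measurableSet

lemma abs_le_of_hits {x : ι → Param d} {r : ℝ} (h : hyperplaneInter x ∈ hitsBall d r) (j : ι) :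
    |(x j).1| ≤ r := by
  obtain ⟨y, hy, hyB⟩ := h
  rw [← mem_hyperplaneInter.1 hy j]
  refine (abs_real_inner_le_norm _ _).trans ?_
  rw [(x j).2.2.1, mul_one]
  simpa using hyB

lemma hitKernel_le_one (r : ℝ) (x : ι → Param d) : hitKernel r x ≤ 1 :=
  Set.indicator_le_self' (fun _ _ => zero_le) _ |>.trans le_rfl

lemma hitKernel_eq_zero {r : ℝ} {x : ι → Param d} {j : ι} (h : r < |(x j).1|) :
    hitKernel r x = 0 :=
  Set.indicator_of_notMem (fun h' => (abs_le_of_hits h' j).not_gt h) _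

lemma volumeKernel_eq_zero_of_notMem {k : ℕ} {r : ℝ} (hr : 0 ≤ r) {x : ι → Param d}
    (h : hyperplaneInter x ∉ hitsBall d r) : volumeKernel k r x = 0 := by
  rw [volumeKernel, flatBallVolume, if_neg]
  rwa [infEDist_le_iff_hits (isClosed_hyperplaneInter x) hr]

lemma volumeKernel_eq_zero {k : ℕ} {r : ℝ} (hr : 0 ≤ r) {x : ι → Param d} {j : ι}
    (h : r < |(x j).1|) : volumeKernel k r x = 0 :=
  volumeKernel_eq_zero_of_notMem hr fun h' => (abs_le_of_hits h' j).not_gt h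

lemma euclideanHausdorffMeasure_hyperplaneInter [Fintype ι] {x : ι → Param d}
    (hx : ¬ DegenerateFamily x) {k : ℕ} (hk : k + Fintype.card ι = d) {r : ℝ} (hr : 0 ≤ r) :
    μHE[k] (hyperplaneInter x ∩ Metric.closedBall 0 r) = volumeKernel k r x := by
  rcases (hyperplaneInter x).eq_empty_or_nonempty with he | hne
  · rw [volumeKernel_eq_zero_of_notMem hr, he, Set.empty_inter, measure_empty]
    simp [he, hitsBall]
  · have hLI : LinearIndependent ℝ (fun j => ((x j).2 : E d)) := by
      by_contra h
      exact hx ⟨h, hne⟩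
    exact euclideanHausdorffMeasure_inter_closedBall (hyperplaneInter_mem_flats hLI hk) hr

end BallVolume

/-! ### Counting flats by tuples of indices. -/

section GeneralPosition

variable {d : ℕ}

/-- No finitely many distinct hyperplanes of the sequence form a degenerate family. -/
def InGeneralPosition (y : ℕ → Param d) : Prop :=
  ∀ (n : ℕ) (a : Fin n ↪ ℕ), ¬ DegenerateFamily fun j => y (a j)

variable {y : ℕ → Param d}

lemma InGeneralPosition.linearIndependent (hy : InGeneralPosition y) {n : ℕ} {a : Fin n ↪ ℕ}
    (h : (hyperplaneInter fun j => y (a j)).Nonempty) :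
    LinearIndependent ℝ (fun j => ((y (a j)).2 : E d)) := by
  by_contra h'
  exact hy n a ⟨h', h⟩

lemma InGeneralPosition.exists_mem_flats (hy : InGeneralPosition y) {n : ℕ} {a : Fin n ↪ ℕ}
    (h : (hyperplaneInter fun j => y (a j)).Nonempty) :
    ∃ k, k + n = d ∧ (hyperplaneInter fun j => y (a j)) ∈ flats d k := by
  have hLI := hy.linearIndependent h
  have hle := hLI.fintype_card_le_finrank
  rw [Fintype.card_fin, finrank_euclideanSpace_fin] at hle
  exact ⟨d - n, by omega, hyperplaneInter_mem_flats hLI (by rw [Fintype.card_fin]; omega)⟩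

lemma InGeneralPosition.mem_flats (hy : InGeneralPosition y) {k : ℕ} (hk : k < d)
    {a : Fin (d - k) ↪ ℕ} (h : (hyperplaneInter fun j => y (a j)).Nonempty) :
    (hyperplaneInter fun j => y (a j)) ∈ flats d k := by
  obtain ⟨k', hk', hf⟩ := hy.exists_mem_flats h
  rwa [show k' = k by omega] at hf

/-- A flat of intersection lies in no further hyperplane. -/
lemma InGeneralPosition.mem_range (hy : InGeneralPosition y) {n : ℕ} {a : Fin n ↪ ℕ}
    (h : (hyperplaneInter fun j => y (a j)).Nonempty) {i : ℕ}
    (hi : (hyperplaneInter fun j => y (a j)) ⊆ hyperplane (y i)) : i ∈ Set.range a := by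
  by_contra hia
  -- Adjoining `i` would leave the intersection unchanged while lowering its dimension by one.
  let b : Fin (n + 1) ↪ ℕ := ⟨Fin.cons i a, Fin.cons_injective_iff.2 ⟨hia, a.injective⟩⟩
  have hb : (hyperplaneInter fun j => y (b j)) = hyperplaneInter fun j => y (a j) := by
    ext z
    rw [mem_hyperplaneInter, mem_hyperplaneInter, Fin.forall_fin_succ]
    refine ⟨fun hz j => hz.2 j, fun hz => ⟨?_, hz⟩⟩
    exact hi (mem_hyperplaneInter.2 hz)
  obtain ⟨k1, hk1, h1⟩ := hy.exists_mem_flats h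
  obtain ⟨k2, hk2, h2⟩ := hy.exists_mem_flats (a := b) (by rw [hb]; exact h)
  rw [hb] at h2
  have := flats_dim_unique h1 h2
  omega

lemma hyperplane_nonempty (x : Param d) : (hyperplane x).Nonempty := by
  refine ⟨x.1 • (x.2 : E d), ?_⟩
  simp [hyperplane, real_inner_smul_left, x.2.2.1]

/-- Lets tuples of distinct hyperplanes be counted as tuples of distinct indices. Different
parameters can describe one hyperplane (opposite normals with last coordinate zero), so general
position is needed here. -/
lemma InGeneralPosition.injective_hyperplane (hy : InGeneralPosition y) :
    Function.Injective fun i => hyperplane (y i) := by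
  intro i j hij
  let a : Fin 1 ↪ ℕ := ⟨fun _ => i, fun _ _ _ => Subsingleton.elim _ _⟩
  have ha : (hyperplaneInter fun l => y (a l)) = hyperplane (y i) := by
    show (⋂ _ : Fin 1, hyperplane (y i)) = _
    exact Set.iInter_const _
  have := hy.mem_range (a := a) (i := j) (by rw [ha]; exact hyperplane_nonempty _)
    (by rw [ha]; exact hij.le)
  obtain ⟨_, h⟩ := this
  exact h

/-- Each hyperplane of `b` contains the flat of `a`, hence is one of the hyperplanes of `a`; so `b`
is a rearrangement of `a`. -/
lemma InGeneralPosition.setOf_hyperplaneInter_eq (hy : InGeneralPosition y) {n : ℕ}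
    {a : Fin n ↪ ℕ} (h : (hyperplaneInter fun j => y (a j)).Nonempty) :
    {b : Fin n ↪ ℕ | (hyperplaneInter fun j => y (b j)) = hyperplaneInter fun j => y (a j)} =
      Set.range fun s : Equiv.Perm (Fin n) => s.toEmbedding.trans a := by
  ext b
  constructor
  · intro hb
    have hr : ∀ j, ∃ i, a i = b j := fun j => by
      refine hy.mem_range h ?_
      rw [← Set.mem_ofPred.1 hb]
      exact Set.iInter_subset _ j
    choose f hf using hr
    have hfi : Function.Injective f := fun i j hij => by
      apply b.injective; rw [← hf, ← hf, hij]
    refine ⟨Equiv.ofBijective f (Finite.injective_iff_bijective.1 hfi), ?_⟩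
    ext j
    exact hf j
  · rintro ⟨s, rfl⟩
    exact hyperplaneInter_comp_equiv (fun j => y (a j)) s

lemma InGeneralPosition.tsum_indicator_eq (hy : InGeneralPosition y) {n : ℕ}
    {a : Fin n ↪ ℕ} (h : (hyperplaneInter fun j => y (a j)).Nonempty) :
    ∑' b : Fin n ↪ ℕ, Set.indicator {hyperplaneInter fun j => y (a j)} (1 : Set (E d) → ℝ≥0∞)
      (hyperplaneInter fun j => y (b j)) = n ! := by
  have h1 : ∀ b : Fin n ↪ ℕ,
      Set.indicator {hyperplaneInter fun j => y (a j)} (1 : Set (E d) → ℝ≥0∞)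
        (hyperplaneInter fun j => y (b j)) =
      Set.indicator (Set.range fun s : Equiv.Perm (Fin n) => s.toEmbedding.trans a)
        (fun _ => 1) b := fun b => by
    rw [← hy.setOf_hyperplaneInter_eq h]
    rfl
  have hinj : Function.Injective fun s : Equiv.Perm (Fin n) => s.toEmbedding.trans a := by
    intro s s' hss
    ext j
    exact congrArg Fin.val (a.injective (DFunLike.congr_fun hss j))
  simp_rw [h1]
  rw [← tsum_subtype (Set.range fun s : Equiv.Perm (Fin n) => s.toEmbedding.trans a)
    (fun _ => (1 : ℝ≥0∞)), tsum_range (fun _ => (1 : ℝ≥0∞)) hinj, tsum_fintype]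
  simp [Fintype.card_perm]

lemma InGeneralPosition.flatProcess_eq (hy : InGeneralPosition y) (k : ℕ) (ℬ : Set (Set (E d))) :
    flatProcess (Set.range fun i => hyperplane (y i)) k ℬ =
      (∑' a : Fin (d - k) ↪ ℕ, (flats d k ∩ ℬ).indicator 1 (hyperplaneInter fun j => y (a j))) /
        (d - k)! := by
  unfold flatProcess
  congr 1
  let e := Equiv.ofInjective _ hy.injective_hyperplane
  rw [← (Equiv.embeddingCongr (Equiv.refl (Fin (d - k))) e).tsum_eq]
  rfl

lemma InGeneralPosition.flatProcess_hitsBall (hy : InGeneralPosition y) {k : ℕ} (hk : k < d)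
    (r : ℝ) : flatProcess (Set.range fun i => hyperplane (y i)) k (hitsBall d r) =
      (∑' a : Fin (d - k) ↪ ℕ, hitKernel r fun j => y (a j)) / (d - k)! := by
  rw [hy.flatProcess_eq]
  congr 1
  refine tsum_congr fun a => ?_
  by_cases h : (hyperplaneInter fun j => y (a j)) ∈ hitsBall d r
  · have hne : (hyperplaneInter fun j => y (a j)).Nonempty := h.mono Set.inter_subset_left
    rw [hitKernel, Set.indicator_of_mem h, Set.indicator_of_mem (by exact ⟨hy.mem_flats hk hne, h⟩)]
  · rw [hitKernel, Set.indicator_of_notMem h, Set.indicator_of_notMem (fun h' => h h'.2)]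

lemma InGeneralPosition.flatProcess_singleton (hy : InGeneralPosition y) {k : ℕ} (hk : k < d)
    {a : Fin (d - k) ↪ ℕ} (h : (hyperplaneInter fun j => y (a j)).Nonempty) :
    flatProcess (Set.range fun i => hyperplane (y i)) k {hyperplaneInter fun j => y (a j)} = 1 := by
  have hmem : (flats d k ∩ {hyperplaneInter fun j => y (a j)}) =
      {hyperplaneInter fun j => y (a j)} := by
    rw [Set.inter_eq_right, Set.singleton_subset_iff]
    exact hy.mem_flats hk h
  rw [hy.flatProcess_eq, hmem, hy.tsum_indicator_eq h]
  exact ENNReal.div_self (by positivity) (by simp)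

lemma InGeneralPosition.exists_of_mem_flatSupport (hy : InGeneralPosition y) {k : ℕ}
    {L : Set (E d)} (hL : L ∈ flatSupport (Set.range fun i => hyperplane (y i)) k) :
    ∃ a : Fin (d - k) ↪ ℕ, (hyperplaneInter fun j => y (a j)) = L := by
  by_contra! h
  have h1 := hL.2
  rw [hy.flatProcess_eq] at h1
  have : ∀ a : Fin (d - k) ↪ ℕ, (flats d k ∩ {L}).indicator (1 : Set (E d) → ℝ≥0∞)
      (hyperplaneInter fun j => y (a j)) = 0 := fun a =>
    Set.indicator_of_notMem (fun h' => h a h'.2) _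
  simp [this] at h1

/-- Double counting of pairs of a flat and a tuple cutting it out: every flat of the support has
exactly `(d - k)!` tuples. Tuples with empty intersection are discarded by `f ∅ = 0`. -/
lemma InGeneralPosition.tsum_flatSupport (hy : InGeneralPosition y) {k : ℕ} (hk : k < d)
    {f : Set (E d) → ℝ≥0∞} (hf : f ∅ = 0) :
    ∑' L : flatSupport (Set.range fun i => hyperplane (y i)) k, f L =
      (∑' a : Fin (d - k) ↪ ℕ, f (hyperplaneInter fun j => y (a j))) / (d - k)! := by
  set S := flatSupport (Set.range fun i => hyperplane (y i)) k with hS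
  have h1 : ∀ a : Fin (d - k) ↪ ℕ, f (hyperplaneInter fun j => y (a j)) =
      ∑' L : S, f L * Set.indicator {(L : Set (E d))} 1 (hyperplaneInter fun j => y (a j)) := by
    intro a
    rcases (hyperplaneInter fun j => y (a j)).eq_empty_or_nonempty with he | hne
    · have : ∀ L : S, f L * Set.indicator {(L : Set (E d))} 1
          (hyperplaneInter fun j => y (a j)) = 0 := fun L => by
        rw [he, Set.indicator_of_notMem, mul_zero]
        rintro h
        exact (flats_nonempty L.2.1).ne_empty (Set.mem_singleton_iff.1 h).symm
      rw [tsum_congr this, tsum_zero, he, hf]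
    · let L0 : S := ⟨hyperplaneInter fun j => y (a j), hy.mem_flats hk hne,
        (hy.flatProcess_singleton hk hne).ge⟩
      rw [tsum_eq_single L0]
      · simp [L0]
      · intro L hL
        rw [Set.indicator_of_notMem, mul_zero]
        exact fun h => hL (Subtype.ext (Set.mem_singleton_iff.1 h).symm)
  have h2 : ∑' a : Fin (d - k) ↪ ℕ, f (hyperplaneInter fun j => y (a j)) =
      ∑' L : S, f L * (d - k)! := by
    simp_rw [h1]
    rw [ENNReal.tsum_comm]
    refine tsum_congr fun L => ?_
    obtain ⟨a, ha⟩ := hy.exists_of_mem_flatSupport L.2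
    rw [ENNReal.tsum_mul_left]
    congr 1
    have := hy.tsum_indicator_eq (a := a) (by rw [ha]; exact flats_nonempty L.2.1)
    rwa [ha] at this
  rw [h2, ENNReal.tsum_mul_right, ENNReal.mul_div_cancel_right]
  · exact_mod_cast Nat.factorial_ne_zero _
  · simp

lemma InGeneralPosition.tsum_flatSupport_volume (hy : InGeneralPosition y) {k : ℕ} (hk : k < d)
    {r : ℝ} (hr : 0 ≤ r) :
    ∑' L : flatSupport (Set.range fun i => hyperplane (y i)) k,
      μHE[k] ((L : Set (E d)) ∩ Metric.closedBall 0 r) =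
      (∑' a : Fin (d - k) ↪ ℕ, volumeKernel k r fun j => y (a j)) / (d - k)! := by
  rw [hy.tsum_flatSupport hk (f := fun L => μHE[k] (L ∩ Metric.closedBall 0 r)) (by simp)]
  congr 1
  refine tsum_congr fun a => ?_
  exact euclideanHausdorffMeasure_hyperplaneInter (hy _ a) (by rw [Fintype.card_fin]; omega) hr

lemma ae_inGeneralPosition {Ω : Type*} [MeasurableSpace Ω] {P : Measure Ω} {lam : ℝ}
    (hlam : 0 < lam) {Θ : Measure (UpperHemisphere d)} [IsProbabilityMeasure Θ]
    {X : ℕ → Ω → Param d} (hX : IsPoissonProcess P (intensityMeasure lam Θ) X) :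
    ∀ᵐ ω ∂P, InGeneralPosition fun i => X i ω :=
  ae_all_iff.2 fun _ =>
    hX.ae_forall_embedding_notMem (pi_intensityMeasure_degenerateFamily hlam Θ)

end GeneralPosition

/-! ### Dilation, and restriction of the process to a fixed ball. -/

section Scaling

variable {d : ℕ} {ι : Type*}

/-- Dilation of a hyperplane by the factor `c`, in terms of its parameters. -/
def scaleParam (c : ℝ) (a : Param d) : Param d := (c * a.1, a.2)

lemma measurable_scaleParam (c : ℝ) : Measurable (scaleParam c : Param d → Param d) :=
  (measurable_fst.const_mul c).prodMk measurable_snd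

lemma scaleParam_scaleParam {c c' : ℝ} (h : c * c' = 1) (a : Param d) :
    scaleParam c (scaleParam c' a) = a := by
  simp [scaleParam, ← mul_assoc, h]

open scoped Pointwise in
lemma hyperplaneInter_scaleParam {c : ℝ} (hc : c ≠ 0) (x : ι → Param d) :
    hyperplaneInter (fun j => scaleParam c (x j)) = c • hyperplaneInter x := by
  ext y
  rw [Set.mem_smul_set_iff_inv_smul_mem₀ hc, mem_hyperplaneInter, mem_hyperplaneInter]
  refine forall_congr' fun j => ?_
  rw [real_inner_smul_left, inv_mul_eq_iff_eq_mul₀ hc]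
  rfl

open scoped Pointwise in
lemma infEDist_hyperplaneInter_scaleParam {c : ℝ} (hc : 0 < c) (x : ι → Param d) :
    Metric.infEDist 0 (hyperplaneInter fun j => scaleParam c (x j)) =
      ENNReal.ofReal c * Metric.infEDist 0 (hyperplaneInter x) := by
  have h := infEDist_smul₀ hc.ne' (hyperplaneInter x) 0
  rw [smul_zero] at h
  rw [hyperplaneInter_scaleParam hc.ne', h, ENNReal.smul_def, smul_eq_mul]
  congr 1
  rw [← enorm_eq_nnnorm, Real.enorm_of_nonneg hc.le]

lemma hitKernel_scaleParam {c r : ℝ} (hc : 0 < c) (hr : 0 ≤ r) (x : ι → Param d) :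
    hitKernel (c * r) (fun j => scaleParam c (x j)) = hitKernel r x := by
  have h : (hyperplaneInter fun j => scaleParam c (x j)) ∈ hitsBall d (c * r) ↔
      hyperplaneInter x ∈ hitsBall d r := by
    rw [← infEDist_le_iff_hits (isClosed_hyperplaneInter _) hr,
      ← infEDist_le_iff_hits (isClosed_hyperplaneInter _) (mul_nonneg hc.le hr),
      infEDist_hyperplaneInter_scaleParam hc, ENNReal.ofReal_mul hc.le,
      ENNReal.mul_le_mul_iff_right (by simpa using hc) ENNReal.ofReal_ne_top]
  by_cases h' : hyperplaneInter x ∈ hitsBall d r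
  · rw [hitKernel, hitKernel, Set.indicator_of_mem h', Set.indicator_of_mem (h.2 h')]
    rfl
  · rw [hitKernel, hitKernel, Set.indicator_of_notMem h',
      Set.indicator_of_notMem (fun h'' => h' (h.1 h''))]

lemma flatBallVolume_mul {c : ℝ} (hc : 0 < c) (k : ℕ) (r : ℝ) (e : ℝ≥0∞) :
    flatBallVolume k (c * r) (ENNReal.ofReal c * e) =
      ENNReal.ofReal (c ^ k) * flatBallVolume k r e := by
  have h : ENNReal.ofReal c * e ≤ ENNReal.ofReal (c * r) ↔ e ≤ ENNReal.ofReal r := by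
    rw [ENNReal.ofReal_mul hc.le,
      ENNReal.mul_le_mul_iff_right (by simpa using hc) ENNReal.ofReal_ne_top]
  unfold flatBallVolume
  simp only [h]
  split_ifs
  · rw [ENNReal.toReal_mul, ENNReal.toReal_ofReal hc.le, mul_pow, mul_pow, ← mul_sub,
      Real.sqrt_mul (sq_nonneg c), Real.sqrt_sq hc.le, Measure.addHaar_closedBall_mul _ _ hc.le
      (Real.sqrt_nonneg _), finrank_euclideanSpace_fin]
  · rw [mul_zero]

lemma volumeKernel_scaleParam {c : ℝ} (hc : 0 < c) (k : ℕ) (r : ℝ) (x : ι → Param d) :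
    volumeKernel k (c * r) (fun j => scaleParam c (x j)) =
      ENNReal.ofReal (c ^ k) * volumeKernel k r x := by
  rw [volumeKernel, infEDist_hyperplaneInter_scaleParam hc, flatBallVolume_mul hc, volumeKernel]

lemma IsPoissonProcess.map {Ω β γ : Type*} [MeasurableSpace Ω] [MeasurableSpace β]
    [MeasurableSpace γ] {P : Measure Ω} {μ : Measure β} {Y : ℕ → Ω → β}
    (h : IsPoissonProcess P μ Y) {f : β → γ} (hf : Measurable f) :
    IsPoissonProcess P (μ.map f) fun i ω => f (Y i ω) where
  measurable i := hf.comp (h.measurable i)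
  count_poisson B hB hμ := by
    rw [Measure.map_apply hf hB] at hμ ⊢
    exact h.count_poisson _ (hf hB) hμ
  count_indep n B hB hd :=
    h.count_indep n (fun j => f ⁻¹' B j) (fun j => hf (hB j)) fun i j hij => (hd hij).preimage f

variable (Θ : Measure (UpperHemisphere d)) [IsProbabilityMeasure Θ]

lemma map_scaleParam_intensityMeasure {lam c : ℝ} (hc : 0 < c) :
    (intensityMeasure lam Θ).map (scaleParam c) = intensityMeasure (lam / c) Θ := by
  have hs : SigmaFinite (ENNReal.ofReal lam • (volume : Measure ℝ)) :=
    inferInstanceAs (SigmaFinite (lam.toNNReal • (volume : Measure ℝ)))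
  have h := Measure.map_prod_map (ENNReal.ofReal lam • (volume : Measure ℝ)) Θ
    (measurable_const_mul c) measurable_id
  rw [Measure.map_id, Measure.map_smul, Real.map_volume_mul_left hc.ne', smul_smul,
    ← ENNReal.ofReal_mul' (abs_nonneg _), abs_of_pos (inv_pos.2 hc), ← div_eq_mul_inv] at h
  exact h.symm

instance isProbabilityMeasure_sampleLaw (ρ : ℝ) [Fact (0 < ρ)] :
    IsProbabilityMeasure (sampleLaw Θ ρ) := by
  have hρ : 0 < ρ := Fact.out
  have : IsProbabilityMeasure (ProbabilityTheory.cond (volume : Measure ℝ) (Set.Icc (-ρ) ρ)) :=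
    cond_isProbabilityMeasure_of_finite (by simp [hρ]) (by simp)
  unfold sampleLaw
  infer_instance

/-- The parameters of hyperplanes at distance at most `ρ` from the origin. -/
def slab (d : ℕ) (ρ : ℝ) : Set (Param d) := Set.Icc (-ρ) ρ ×ˢ Set.univ

lemma measurableSet_slab (ρ : ℝ) : MeasurableSet (slab d ρ) :=
  measurableSet_Icc.prod MeasurableSet.univ

lemma lt_abs_of_notMem_slab {ρ : ℝ} {a : Param d} (h : a ∉ slab d ρ) : ρ < |a.1| := by
  by_contra h'
  exact h ⟨abs_le.1 (not_lt.1 h'), trivial⟩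

lemma restrict_intensityMeasure {ρ : ℝ} (hρ : 0 < ρ) {lam : ℝ} (hlam : 0 ≤ lam) :
    (intensityMeasure lam Θ).restrict (slab d ρ) =
      ENNReal.ofReal (2 * lam * ρ) • sampleLaw Θ ρ := by
  have hs : SigmaFinite (ENNReal.ofReal lam • (volume : Measure ℝ)) :=
    inferInstanceAs (SigmaFinite (lam.toNNReal • (volume : Measure ℝ)))
  rw [intensityMeasure, slab, ← Measure.prod_restrict, Measure.restrict_univ, Measure.restrict_smul,
    sampleLaw, ProbabilityTheory.cond, Measure.prod_smul_left, Measure.prod_smul_left, smul_smul,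
    Real.volume_Icc]
  congr 1
  rw [← ENNReal.ofReal_inv_of_pos (by linarith), ← ENNReal.ofReal_mul (by positivity)]
  congr 1
  field_simp
  ring

/-- On the slab, `sampleLaw` is a positive multiple of the intensity measure, so null sets carry
over. -/
lemma ae_pi_sampleLaw_not_degenerateFamily [Fintype ι] (ρ : ℝ) [Fact (0 < ρ)] :
    ∀ᵐ x ∂(Measure.pi fun _ : ι => sampleLaw Θ ρ), ¬ DegenerateFamily x := by
  have hρ : 0 < ρ := Fact.out
  have h := pi_intensityMeasure_degenerateFamily (ι := ι) one_pos Θ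
  have h' := measure_mono_null (s := {x : ι → Param d | DegenerateFamily x} ∩
    Set.univ.pi fun _ => slab d ρ) Set.inter_subset_left h
  rw [← Measure.restrict_apply measurableSet_degenerateFamily, Measure.restrict_pi_pi,
    restrict_intensityMeasure Θ hρ zero_le_one, pi_smul_const _ ENNReal.ofReal_ne_top,
    Measure.smul_apply, smul_eq_mul, mul_eq_zero] at h'
  rw [ae_iff]
  simp only [not_not]
  refine h'.resolve_left (pow_ne_zero _ ?_)
  simpa using hρ

end Scaling

/-! ### Identification of the limiting variances. -/

section Variance

variable {d : ℕ}

/-- The positions of the first tuple, among two tuples that share one entry. -/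
def firstIndex (n : ℕ) (j : Fin (n + 1)) : Fin (2 * (n + 1) - 1) := ⟨j, by omega⟩

/-- The positions of the second tuple, among two tuples that share one entry. -/
def secondIndex (n : ℕ) (j : Fin (n + 1)) : Fin (2 * (n + 1) - 1) := ⟨n + j, by omega⟩

lemma injective_firstIndex (n : ℕ) : Function.Injective (firstIndex n) := fun i j h => by
  simpa [firstIndex, Fin.ext_iff] using h

lemma injective_secondIndex (n : ℕ) : Function.Injective (secondIndex n) := fun i j h => by
  simpa [secondIndex, Fin.ext_iff] using h

lemma firstIntersection_eq {n : ℕ} (x : Fin (2 * (n + 1) - 1) → Param d) :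
    firstIntersection x = hyperplaneInter fun j => x (firstIndex n j) := by
  refine subset_antisymm (Set.subset_iInter fun j => ?_) (Set.subset_iInter fun i => ?_)
  · exact Set.iInter_subset (fun i : {i : Fin (2 * (n + 1) - 1) // (i : ℕ) + 1 ≤ n + 1} =>
      hyperplane (x i)) ⟨firstIndex n j, j.2⟩
  · have hi := i.2
    exact Set.iInter_subset (fun j : Fin (n + 1) => hyperplane (x (firstIndex n j)))
      ⟨i, by omega⟩

lemma secondIntersection_eq {n : ℕ} (x : Fin (2 * (n + 1) - 1) → Param d) :
    secondIntersection x = hyperplaneInter fun j => x (secondIndex n j) := by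
  refine subset_antisymm (Set.subset_iInter fun j => ?_) (Set.subset_iInter fun i => ?_)
  · exact Set.iInter_subset (fun i : {i : Fin (2 * (n + 1) - 1) // n + 1 ≤ (i : ℕ) + 1} =>
      hyperplane (x i)) ⟨secondIndex n j, by simp [secondIndex]⟩
  · have hi := i.2
    have hi' := i.1.2
    have : (i : Fin (2 * (n + 1) - 1)) =
        secondIndex n ⟨(i : Fin (2 * (n + 1) - 1)) - n, by omega⟩ := by
      ext
      simp only [secondIndex]
      omega
    rw [this]
    exact Set.iInter_subset (fun j : Fin (n + 1) => hyperplane (x (secondIndex n j))) _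

/-- Index `n` is both the last entry of the first tuple and entry `0` of the second, so this is
`lintegral_insertNth_pair` after relabelling. -/
lemma lintegral_mul_sharing_entry {β : Type*} [MeasurableSpace β] {Q : Measure β} [SigmaFinite Q]
    {n : ℕ} {g : (Fin (n + 1) → β) → ℝ≥0∞} (hg : Measurable g)
    (hs : ∀ (s : Equiv.Perm (Fin (n + 1))) x, g (x ∘ s) = g x) :
    ∫⁻ x, g (fun j => x (firstIndex n j)) * g (fun j => x (secondIndex n j))
      ∂(Measure.pi fun _ : Fin (2 * (n + 1) - 1) => Q) = ∫⁻ z, firstKernel Q g z ^ 2 ∂Q := by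
  let e : Fin (n + 1) ⊕ Fin n ≃ Fin (2 * (n + 1) - 1) :=
    finSumFinEquiv.trans (finCongr (by omega))
  rw [← lintegral_insertNth_pair hg hs (Fin.last n) 0]
  have h := measurePreserving_piCongrLeft (fun _ : Fin (2 * (n + 1) - 1) => Q) e
  rw [← h.lintegral_comp_emb (MeasurableEquiv.measurableEmbedding _)]
  have happ : ∀ (x : Fin (n + 1) ⊕ Fin n → β) (i : Fin (n + 1) ⊕ Fin n),
      MeasurableEquiv.piCongrLeft (fun _ : Fin (2 * (n + 1) - 1) => β) e x (e i) = x i :=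
    fun x i => MeasurableEquiv.piCongrLeft_apply_apply (β := fun _ => β) e x i
  refine lintegral_congr fun x => ?_
  congr 2
  · funext j
    exact happ x (.inl j)
  · rw [Fin.insertNth_zero']
    funext j
    refine Fin.cases ?_ (fun i => ?_) j
    · exact happ x (.inl (Fin.last n))
    · have hi : secondIndex n i.succ = e (.inr i) := by
        ext
        simp [secondIndex, e]
        omega
      rw [Fin.cons_succ, hi]
      exact happ x (.inr i)

lemma measurePreserving_precomp {β ι κ : Type*} [MeasurableSpace β] [Fintype ι] [Fintype κ]
    (Q : Measure β) [IsProbabilityMeasure Q] {f : κ → ι} (hf : Function.Injective f) :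
    MeasurePreserving (fun (x : ι → β) j => x (f j)) (Measure.pi fun _ => Q)
      (Measure.pi fun _ => Q) := by
  have hm : Measurable fun (x : ι → β) (j : κ) => x (f j) := by fun_prop
  refine ⟨hm, ?_⟩
  have h : iIndepFun (fun (i : ι) (x : ι → β) => x i) (Measure.pi fun _ => Q) :=
    iIndepFun_pi (X := fun _ : ι => id) fun _ => aemeasurable_id
  have h' := (iIndepFun_iff_map_fun_eq_pi_map fun j =>
    (measurable_pi_apply (f j)).aemeasurable).1 (h.precomp hf)
  rw [h']
  congr 1
  funext j
  exact (measurePreserving_eval (fun _ : ι => Q) (f j)).map_eq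

lemma hitKernel_comp_perm {ι : Type*} (r : ℝ) (s : Equiv.Perm ι) (x : ι → Param d) :
    hitKernel r (x ∘ s) = hitKernel r x := by
  rw [hitKernel, hyperplaneInter_comp_equiv, hitKernel]

lemma volumeKernel_comp_perm {ι : Type*} (k : ℕ) (r : ℝ) (s : Equiv.Perm ι) (x : ι → Param d) :
    volumeKernel k r (x ∘ s) = volumeKernel k r x := by
  rw [volumeKernel, hyperplaneInter_comp_equiv, volumeKernel]

/-- Finiteness makes the `toNNReal` in `sigmaChi` and `sigmaNu` lossless. -/
lemma lintegral_firstKernel_sq_ne_top {β : Type*} [MeasurableSpace β] {Q : Measure β}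
    [IsProbabilityMeasure Q] {n : ℕ} {g : (Fin (n + 1) → β) → ℝ≥0∞} {C : ℝ≥0}
    (hC : ∀ x, g x ≤ C) : ∫⁻ z, firstKernel Q g z ^ 2 ∂Q ≠ ∞ := by
  have h1 : ∀ z, firstKernel Q g z ≤ C := fun z =>
    (lintegral_mono fun w => hC _).trans (by simp)
  have h2 : ∫⁻ z, firstKernel Q g z ^ 2 ∂Q ≤ C ^ 2 :=
    (lintegral_mono fun z => pow_le_pow_left' (h1 z) 2).trans (by simp)
  exact (h2.trans_lt (ENNReal.pow_lt_top ENNReal.coe_lt_top)).ne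

variable (Θ : Measure (UpperHemisphere d)) [IsProbabilityMeasure Θ] (ρ : ℝ) [Fact (0 < ρ)]

lemma coe_sigmaChi {k n : ℕ} (hn : d - k = n + 1) :
    ∫⁻ z, firstKernel (sampleLaw Θ ρ)
      (hitKernel ρ : (Fin (n + 1) → Param d) → ℝ≥0∞) z ^ 2 ∂(sampleLaw Θ ρ) =
        sigmaChi Θ k ρ := by
  rw [sigmaChi, hn]
  simp_rw [firstIntersection_eq, secondIntersection_eq]
  have h := lintegral_mul_sharing_entry (Q := sampleLaw Θ ρ) (measurable_hitKernel (d := d) ρ)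
    (n := n) fun s x => hitKernel_comp_perm ρ s x
  have hfin := lintegral_firstKernel_sq_ne_top (Q := sampleLaw Θ ρ) (n := n) (C := 1)
    (hitKernel_le_one (d := d) ρ)
  rw [← h] at hfin ⊢
  exact (ENNReal.coe_toNNReal hfin).symm

/-- The volume kernel, rescaled to the unit ball. -/
noncomputable def unitVolumeKernel {ι : Type*} (k : ℕ) (ρ : ℝ) (x : ι → Param d) : ℝ≥0∞ :=
  (ENNReal.ofReal (ρ ^ k))⁻¹ * volumeKernel k ρ x

lemma exists_unitVolumeKernel_le {ι : Type*} (k : ℕ) {ρ : ℝ} (hρ : 0 < ρ) :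
    ∃ C : ℝ≥0, ∀ x : ι → Param d, unitVolumeKernel k ρ x ≤ C := by
  have h : (ENNReal.ofReal (ρ ^ k))⁻¹ *
      volume (Metric.closedBall (0 : EuclideanSpace ℝ (Fin k)) |ρ|) ≠ ∞ :=
    ENNReal.mul_ne_top (by simpa using pow_pos hρ k) measure_closedBall_lt_top.ne
  lift (ENNReal.ofReal (ρ ^ k))⁻¹ *
    volume (Metric.closedBall (0 : EuclideanSpace ℝ (Fin k)) |ρ|) to ℝ≥0 using h with C hC
  refine ⟨C, fun x => ?_⟩
  rw [hC]
  exact mul_le_mul_right (flatBallVolume_le k ρ _) _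

lemma coe_sigmaNu {k n : ℕ} (hn : d - k = n + 1) :
    ∫⁻ z, firstKernel (sampleLaw Θ ρ)
      (unitVolumeKernel k ρ : (Fin (n + 1) → Param d) → ℝ≥0∞) z ^ 2 ∂(sampleLaw Θ ρ) =
        sigmaNu Θ k ρ := by
  have hρ : 0 < ρ := Fact.out
  have hcard : k + Fintype.card (Fin (n + 1)) = d := by rw [Fintype.card_fin]; omega
  have hm : Measurable (volumeKernel k ρ : (Fin (n + 1) → Param d) → ℝ≥0∞) :=
    measurable_volumeKernel k ρ
  have h := lintegral_mul_sharing_entry (Q := sampleLaw Θ ρ) (n := n) (hm.const_mul _)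
    fun s x => congrArg ((ENNReal.ofReal (ρ ^ k))⁻¹ * ·) (volumeKernel_comp_perm k ρ s x)
  obtain ⟨C, hC⟩ := exists_unitVolumeKernel_le (d := d) (ι := Fin (n + 1)) k hρ
  have hfin := lintegral_firstKernel_sq_ne_top (Q := sampleLaw Θ ρ) hC
  -- Both tuples are almost surely nondegenerate, so the Hausdorff measures may be replaced by
  -- `volumeKernel`.
  have hnd := ae_pi_sampleLaw_not_degenerateFamily (ι := Fin (n + 1)) Θ ρ
  have h1 := (measurePreserving_precomp (sampleLaw Θ ρ)
    (injective_firstIndex n)).quasiMeasurePreserving.ae hnd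
  have h2 := (measurePreserving_precomp (sampleLaw Θ ρ)
    (injective_secondIndex n)).quasiMeasurePreserving.ae hnd
  have hc : (ENNReal.ofReal (ρ ^ (2 * k)))⁻¹ =
      (ENNReal.ofReal (ρ ^ k))⁻¹ * (ENNReal.ofReal (ρ ^ k))⁻¹ := by
    rw [← ENNReal.mul_inv (by simp) (by simp), ← ENNReal.ofReal_mul (by positivity), two_mul,
      pow_add]
  have key : (ENNReal.ofReal (ρ ^ (2 * k)))⁻¹ * ∫⁻ x : Fin (2 * (n + 1) - 1) → Param d,
      μHE[k] (firstIntersection x ∩ Metric.closedBall 0 ρ) *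
        μHE[k] (secondIntersection x ∩ Metric.closedBall 0 ρ)
      ∂(Measure.pi fun _ => sampleLaw Θ ρ) = ∫⁻ z, firstKernel (sampleLaw Θ ρ)
      (unitVolumeKernel k ρ : (Fin (n + 1) → Param d) → ℝ≥0∞) z ^ 2 ∂(sampleLaw Θ ρ) := by
    refine Eq.trans ?_ h
    rw [← lintegral_const_mul' _ _ (by simpa using pow_pos hρ (2 * k))]
    refine lintegral_congr_ae ?_
    filter_upwards [h1, h2] with x hx1 hx2
    rw [firstIntersection_eq, secondIntersection_eq,
      euclideanHausdorffMeasure_hyperplaneInter hx1 hcard hρ.le,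
      euclideanHausdorffMeasure_hyperplaneInter hx2 hcard hρ.le, hc]
    ring
  rw [sigmaNu, hn, key, ENNReal.coe_toNNReal hfin]

end Variance

/-! ### Integrability and limit theorems for the flat statistics. -/

lemma flatVolume_of_neg {Ω : Type*} {d k : ℕ} {X : ℕ → Ω → Param d} {r : ℝ} (hr : r < 0) :
    flatVolume X k r = 0 := by
  funext ω
  simp [flatVolume, Metric.closedBall_eq_empty.2 hr]

section FlatStatistics

variable {Ω : Type*} [MeasurableSpace Ω] {P : Measure Ω} {d : ℕ} {lam : ℝ}
  {Θ : Measure (UpperHemisphere d)} {X : ℕ → Ω → Param d} {k n : ℕ}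

lemma IsPoissonHyperplaneProcess.isPoissonProcess (hX : IsPoissonHyperplaneProcess P lam Θ X) :
    IsPoissonProcess P (intensityMeasure lam Θ) X :=
  ⟨hX.measurable, hX.count_poisson, hX.count_indep⟩

variable [IsProbabilityMeasure Θ]

lemma flatNumber_ae_eq (hlam : 0 < lam) (hX : IsPoissonHyperplaneProcess P lam Θ X)
    (hn : d - k = n + 1) (r : ℝ) :
    flatNumber X k r =ᵐ[P] fun ω =>
      (∑' a : Fin (n + 1) ↪ ℕ, hitKernel r fun j => X (a j) ω).toReal / (n + 1)! := by
  filter_upwards [ae_inGeneralPosition hlam hX.isPoissonProcess] with ω hω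
  have h := hω.flatProcess_hitsBall (k := k) (by omega) r
  rw [hn] at h
  rw [flatNumber, hyperplanes, h, ENNReal.toReal_div, ENNReal.toReal_natCast]

lemma flatVolume_ae_eq (hlam : 0 < lam) (hX : IsPoissonHyperplaneProcess P lam Θ X)
    (hn : d - k = n + 1) {r : ℝ} (hr : 0 ≤ r) :
    flatVolume X k r =ᵐ[P] fun ω =>
      (∑' a : Fin (n + 1) ↪ ℕ, volumeKernel k r fun j => X (a j) ω).toReal / (n + 1)! := by
  filter_upwards [ae_inGeneralPosition hlam hX.isPoissonProcess] with ω hω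
  have h := hω.tsum_flatSupport_volume (k := k) (by omega) hr
  rw [hn] at h
  rw [flatVolume, hyperplanes, h, ENNReal.toReal_div, ENNReal.toReal_natCast]

/-- The mean is the integral of a bounded kernel over a power of a slab of finite mass. -/
lemma integrable_tsum_embedding (hlam : 0 < lam) (hX : IsPoissonHyperplaneProcess P lam Θ X)
    {g : (Fin n → Param d) → ℝ≥0∞} (hg : Measurable g) {C : ℝ≥0∞} (hCtop : C ≠ ∞)
    (hC : ∀ x, g x ≤ C) {ρ : ℝ} (hρ : 0 < ρ) (hg0 : ∀ x, (∃ j, x j ∉ slab d ρ) → g x = 0) :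
    Integrable (fun ω => (∑' a : Fin n ↪ ℕ, g fun j => X (a j) ω).toReal) P := by
  have : Fact (0 < ρ) := ⟨hρ⟩
  refine integrable_toReal_of_lintegral_ne_top (Measurable.tsum fun a => hg.comp
    (measurable_pi_lambda _ fun j => hX.measurable _)).aemeasurable ?_
  rw [hX.isPoissonProcess.lintegral_tsum_embedding hg,
    lintegral_pi_of_restrict ENNReal.ofReal_ne_top (measurableSet_slab ρ)
      (restrict_intensityMeasure Θ hρ hlam.le) hg0]
  refine ENNReal.mul_ne_top (ENNReal.pow_ne_top ENNReal.ofReal_ne_top) ?_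
  refine ((lintegral_mono hC).trans_lt ?_).ne
  simpa using hCtop.lt_top

lemma integrable_flatNumber (hlam : 0 < lam) (hX : IsPoissonHyperplaneProcess P lam Θ X)
    (hk : k < d) (r : ℝ) : Integrable (flatNumber X k r) P := by
  obtain ⟨n, hn⟩ : ∃ n, d - k = n + 1 := ⟨d - k - 1, by omega⟩
  refine (integrable_congr (flatNumber_ae_eq hlam hX hn r)).2 (Integrable.div_const ?_ _)
  -- `|r| + 1` is a positive slab width for every real `r`, including `r ≤ 0`.
  refine integrable_tsum_embedding hlam hX (measurable_hitKernel r) ENNReal.one_ne_top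
    (hitKernel_le_one r) (ρ := |r| + 1) (by positivity) ?_
  rintro x ⟨j, hj⟩
  have := lt_abs_of_notMem_slab hj
  exact hitKernel_eq_zero (j := j) (by linarith [le_abs_self r])

lemma integrable_flatVolume (hlam : 0 < lam) (hX : IsPoissonHyperplaneProcess P lam Θ X)
    (hk : k < d) (r : ℝ) : Integrable (flatVolume X k r) P := by
  rcases lt_or_ge r 0 with hr | hr
  · rw [flatVolume_of_neg hr]
    exact integrable_zero _ _ _
  obtain ⟨n, hn⟩ : ∃ n, d - k = n + 1 := ⟨d - k - 1, by omega⟩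
  refine (integrable_congr (flatVolume_ae_eq hlam hX hn hr)).2 (Integrable.div_const ?_ _)
  refine integrable_tsum_embedding hlam hX (measurable_volumeKernel k r)
    measure_closedBall_lt_top.ne (fun x => flatBallVolume_le k r _) (ρ := r + 1) (by positivity) ?_
  rintro x ⟨j, hj⟩
  have := lt_abs_of_notMem_slab hj
  exact volumeKernel_eq_zero hr (j := j) (by linarith)

/-- Central limit theorem for statistics that, after rescaling, are U-statistics of a fixed
kernel. -/
lemma tendstoInDistribution_of_scaling [IsProbabilityMeasure P] (hlam : 0 < lam)
    (hX : IsPoissonHyperplaneProcess P lam Θ X) (hn : d - k = n + 1) {ρ : ℝ} [Fact (0 < ρ)]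
    {g : (Fin (n + 1) → Param d) → ℝ≥0∞} (hg : Measurable g)
    (hs : ∀ (s : Equiv.Perm (Fin (n + 1))) x, g (x ∘ s) = g x)
    {C : ℝ≥0} (hC : ∀ x, g x ≤ C) (hg0 : ∀ x, (∃ j, x j ∉ slab d ρ) → g x = 0)
    {v : ℝ≥0} (hv : ∫⁻ z, firstKernel (sampleLaw Θ ρ) g z ^ 2 ∂(sampleLaw Θ ρ) = v)
    {S : ℝ → Ω → ℝ} (hSm : ∀ r, AEMeasurable (S r) P) {b : ℝ → ℝ}
    (hS : ∀ r, 0 < r → (fun ω => b r * S r ω) =ᵐ[P] fun ω =>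
      (∑' a : Fin (n + 1) ↪ ℕ, g fun j => scaleParam (ρ / r) (X (a j) ω)).toReal / (n + 1)!) :
    TendstoInDistribution (fun (r : ℝ) (ω : Ω) =>
      ((d - k - 1)! : ℝ) * b r / (2 * lam * r) ^ ((d : ℝ) - k - 1 / 2) *
        (S r ω - ∫ ω', S r ω' ∂P)) atTop id (fun _ => P) (gaussianReal 0 v) := by
  have hρ : 0 < ρ := Fact.out
  have ht : Tendsto (fun r : ℝ => 2 * lam * r) atTop atTop :=
    tendsto_id.const_mul_atTop (by positivity)
  have hmeas : ∀ (r : ℝ) i, Measurable fun ω => scaleParam (ρ / r) (X i ω) := fun r i =>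
    (measurable_scaleParam _).comp (hX.measurable i)
  have hY : ∀ᶠ r : ℝ in atTop, IsPoissonProcess P (intensityMeasure (lam / (ρ / r)) Θ)
      fun i ω => scaleParam (ρ / r) (X i ω) := by
    filter_upwards [eventually_gt_atTop 0] with r hr
    rw [← map_scaleParam_intensityMeasure Θ (div_pos hρ hr)]
    exact hX.isPoissonProcess.map (measurable_scaleParam _)
  -- The dilated process has intensity `lam * r / ρ`, so the slab of half-width `ρ` has mass `2 *
  -- lam * r`, in which `ρ` cancels.
  have hμ : ∀ᶠ r : ℝ in atTop, (intensityMeasure (lam / (ρ / r)) Θ).restrict (slab d ρ) =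
      ENNReal.ofReal (2 * lam * r) • sampleLaw Θ ρ := by
    filter_upwards [eventually_gt_atTop 0] with r hr
    rw [restrict_intensityMeasure Θ hρ (by positivity)]
    congr 2
    field_simp
  have hlim := tendstoInDistribution_tsum_embedding (P := P) ht hmeas hY (measurableSet_slab ρ) hμ
    hg hs hC hg0 hv
  have hm : ∀ r : ℝ, AEMeasurable (fun ω => ((d - k - 1)! : ℝ) * b r /
      (2 * lam * r) ^ ((d : ℝ) - k - 1 / 2) * (S r ω - ∫ ω', S r ω' ∂P)) P := fun r =>
    ((hSm r).sub_const _).const_mul _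
  refine ⟨hm, hlim.aemeasurable_limit, hlim.tendsto.congr' ?_⟩
  filter_upwards [eventually_gt_atTop 0] with r hr
  refine Subtype.ext (Measure.map_congr ?_)
  have hint : b r * ∫ ω', S r ω' ∂P = (∫ ω', (∑' a : Fin (n + 1) ↪ ℕ,
      g fun j => scaleParam (ρ / r) (X (a j) ω')).toReal ∂P) / (n + 1)! := by
    rw [← integral_const_mul, integral_congr_ae (hS r hr), integral_div]
  have ht0 : 0 < 2 * lam * r := by positivity
  -- The exponent `d - k - 1/2` is `n + 1/2`.
  have hpow : (2 * lam * r) ^ ((d : ℝ) - k - 1 / 2) = √(2 * lam * r) * (2 * lam * r) ^ n := by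
    have hd : (d : ℝ) - k - 1 / 2 = 1 / 2 + (n : ℝ) := by
      have : (d : ℝ) = n + 1 + k := by exact_mod_cast (by omega : d = n + 1 + k)
      rw [this]; ring
    rw [hd, Real.rpow_add ht0, Real.rpow_natCast, Real.sqrt_eq_rpow]
  have hfac : ((n + 1)! : ℝ) = (n + 1) * n ! := by
    rw [Nat.factorial_succ]; push_cast; ring
  have hfac0 : (n ! : ℝ) ≠ 0 := by exact_mod_cast Nat.factorial_ne_zero n
  have hn1 : (n : ℝ) + 1 ≠ 0 := by positivity
  have hsq : √(2 * lam * r) ≠ 0 := (Real.sqrt_pos.2 ht0).ne'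
  filter_upwards [hS r hr] with ω hω
  -- The quotient `n! / (n + 1)!` supplies the factor `1 / (n + 1)` in the normalisation of the
  -- U-statistic.
  have hsplit : ((d - k - 1)! : ℝ) * b r / (2 * lam * r) ^ ((d : ℝ) - k - 1 / 2) *
      (S r ω - ∫ ω', S r ω' ∂P) = (n ! : ℝ) / (√(2 * lam * r) * (2 * lam * r) ^ n) *
        (b r * S r ω - b r * ∫ ω', S r ω' ∂P) := by
    rw [hpow, show d - k - 1 = n by omega]
    ring
  rw [hsplit, hω, hint, hfac]
  field_simp

end FlatStatistics

theorem theorem4p1 {Ω : Type*} [MeasurableSpace Ω] (P : Measure Ω) [IsProbabilityMeasure P]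
    (d : ℕ) (lam : ℝ) (hlam : 0 < lam)
    (Θ : Measure (UpperHemisphere d)) [IsProbabilityMeasure Θ] (hΘ : NondegenerateOrientation Θ)
    (X : ℕ → Ω → Param d) (hX : IsPoissonHyperplaneProcess P lam Θ X)
    (k : ℕ) (hk : k < d) (ρ : ℝ) (hρ : 0 < ρ) :
    ((∀ r : ℝ, Integrable (flatNumber X k r) P) ∧
      TendstoInDistribution
        (fun (r : ℝ) (ω : Ω) =>
          ((d - k - 1)! : ℝ) / (2 * lam * r) ^ ((d : ℝ) - k - 1 / 2) *
            (flatNumber X k r ω - ∫ ω', flatNumber X k r ω' ∂P))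
        atTop id (fun _ => P) (gaussianReal 0 (sigmaChi Θ k ρ))) ∧
    ((∀ r : ℝ, Integrable (flatVolume X k r) P) ∧
      TendstoInDistribution
        (fun (r : ℝ) (ω : Ω) =>
          ((d - k - 1)! : ℝ) * (r ^ k)⁻¹ / (2 * lam * r) ^ ((d : ℝ) - k - 1 / 2) *
            (flatVolume X k r ω - ∫ ω', flatVolume X k r ω' ∂P))
        atTop id (fun _ => P) (gaussianReal 0 (sigmaNu Θ k ρ))) := by
  obtain ⟨n, hn⟩ : ∃ n, d - k = n + 1 := ⟨d - k - 1, by omega⟩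
  have : Fact (0 < ρ) := ⟨hρ⟩
  have hinv : ∀ r : ℝ, 0 < r → ∀ a : Param d, scaleParam (r / ρ) (scaleParam (ρ / r) a) = a :=
    fun r hr a => scaleParam_scaleParam (by field_simp) a
  have hmul : ∀ r : ℝ, r / ρ * ρ = r := fun r => div_mul_cancel₀ r hρ.ne'
  refine ⟨⟨integrable_flatNumber hlam hX hk, ?_⟩, integrable_flatVolume hlam hX hk, ?_⟩
  · have h := tendstoInDistribution_of_scaling hlam hX hn (measurable_hitKernel ρ)
      (hitKernel_comp_perm ρ) (C := 1) (hitKernel_le_one ρ)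
      (fun x ⟨j, hj⟩ => hitKernel_eq_zero (lt_abs_of_notMem_slab hj)) (coe_sigmaChi Θ ρ hn)
      (S := flatNumber X k) (fun r => (integrable_flatNumber hlam hX hk r).aemeasurable)
      (b := fun _ => 1) fun r hr => by
        filter_upwards [flatNumber_ae_eq hlam hX hn r] with ω hω
        rw [one_mul, hω]
        congr 2
        refine tsum_congr fun a => ?_
        rw [← hitKernel_scaleParam (div_pos hr hρ) hρ.le, hmul]
        simp only [hinv r hr]
    simpa only [mul_one] using h
  · obtain ⟨C, hC⟩ := exists_unitVolumeKernel_le (d := d) (ι := Fin (n + 1)) k hρ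
    refine tendstoInDistribution_of_scaling hlam hX hn ((measurable_volumeKernel k ρ).const_mul _)
      (fun s x => congrArg ((ENNReal.ofReal (ρ ^ k))⁻¹ * ·) (volumeKernel_comp_perm k ρ s x)) hC
      (fun x ⟨j, hj⟩ => ?_) (coe_sigmaNu Θ ρ hn)
      (S := flatVolume X k) (fun r => (integrable_flatVolume hlam hX hk r).aemeasurable)
      (b := fun r => (r ^ k)⁻¹) fun r hr => ?_
    · rw [volumeKernel_eq_zero hρ.le (lt_abs_of_notMem_slab hj), mul_zero]
    · filter_upwards [flatVolume_ae_eq hlam hX hn hr.le] with ω hω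
      -- Dilation multiplies `k`-volume by `(r / ρ) ^ k`; the factor `r ^ k` is removed by `b`, and
      -- `ρ ^ k` is built into `unitVolumeKernel`.
      have hker : ∀ a : Fin (n + 1) ↪ ℕ, (volumeKernel k r fun j => X (a j) ω) =
          ENNReal.ofReal ((r / ρ) ^ k) *
            volumeKernel k ρ fun j => scaleParam (ρ / r) (X (a j) ω) := fun a => by
        rw [← volumeKernel_scaleParam (div_pos hr hρ), hmul]
        simp only [hinv r hr]
      simp_rw [hω, hker, ENNReal.tsum_mul_left, ENNReal.toReal_mul, ENNReal.toReal_inv]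
      rw [ENNReal.toReal_ofReal (by positivity), ENNReal.toReal_ofReal (by positivity), div_pow]
      field_simp
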